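/- Let $n\ge 0$ and let $M_n$ be the space of complex $n\times n$ matrices with coordinate functions $x_{ij}$, equipped with the quadratic Poisson structure $\pi_n$ whose bracket on holomorphic functions is determined by $$\{x_{ij},x_{kl}\}=\bigl(\operatorname{sign}(k-i)+\operatorname{sign}(l-j)\bigr)\,x_{il}\,x_{kj}.$$ The Hamiltonian vector field of a holomorphic function $h$ on $M_n$ is the one whose integral curves satisfy $x_{kl}'(t)=\{x_{kl},h\}(X(t))$ for all $k,l$. For $I,J\subset\{1,\dots,n\}$ with $|I|=|J|$ let $\Delta_{I,J}$ denote the minor with rows $I$ and columns $J$. Let $s_1,\dots,s_{n-1}$ be the simple reflections of the symmetric group $S_n$, let $w_\circ\in S_n$ be its longest element, $w_\circ(a)=n+1-a$, and put $N=n(n-1)/2$. Let $w_\circ=s_{j_1}s_{j_2}\cdots s_{j_N}$ be any reduced expression of $w_\circ$. For $k=1,\dots,N$ put $$v_k=s_{j_1}\cdots s_{j_{k-1}},\qquad u_k=w_\circ^{-1}v_k,\qquad H_k=\Delta_{u_k[1,j_k],\,v_k[1,j_k]},\qquad [1,j]=\{1,\dots,j\}$$ (the Kogan–Zelevinsky Hamiltonians).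 Then: 1. The Hamiltonian flow of each $H_k$ on $(M_n,\pi_n)$ is complete: through every $X_0\in M_n$ passes an integral curve of the Hamiltonian vector field of $H_k$ that is defined on all of $\mathbb C$. 2. There is an analytic Hamiltonian action of the additive group $\mathbb C^{N}$ on $(M_n,\pi_n)$ with moment map $(H_1,\dots,H_N)$; that is, an action $\Phi:\mathbb C^{N}\times M_n\to M_n$ that is (jointly) complex analytic, such that for every $v\in\mathbb C^{N}$ the infinitesimal generator $X\mapsto\frac{d}{dt}\big|_{t=0}\Phi(tv,X)$ is the Hamiltonian vector field of $\sum_k v_kH_k$, such that $\{H_k,H_l\}=0$ for all $k,l$, and such that every $H_k$ is invariant under the action. -/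

import Mathlib

-- The space `M_n` of complex `n × n` matrices carries the (entrywise) sup norm; as it is
-- finite-dimensional, derivatives and analyticity do not depend on the choice of norm.
attribute [local instance] Matrix.normedAddCommGroup Matrix.normedSpace

noncomputable section

namespace KZ

/-! ### The Poisson structure `π_n` on `M_n` -/

/-- The partial derivative `∂f/∂x_{ij}` at the point `X` of a holomorphic function `f` on `M_n`. -/
def partialDeriv {n : ℕ} (f : Matrix (Fin n) (Fin n) ℂ → ℂ) (i j : Fin n)
    (X : Matrix (Fin n) (Fin n) ℂ) : ℂ :=
  fderiv ℂ f X (Matrix.single i j 1)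

/-- `sign (b - a)`, as a complex number. -/
def sgn {n : ℕ} (a b : Fin n) : ℂ := ((Int.sign ((b : ℤ) - (a : ℤ)) : ℤ) : ℂ)

/-- The quadratic Poisson bracket of `(M_n, π_n)` on holomorphic functions, determined by
`{x_{ij}, x_{kl}} = (sign (k - i) + sign (l - j)) x_{il} x_{kj}`. -/
def poissonBracket {n : ℕ} (f g : Matrix (Fin n) (Fin n) ℂ → ℂ)
    (X : Matrix (Fin n) (Fin n) ℂ) : ℂ :=
  ∑ i, ∑ k, ∑ j, ∑ l, (sgn i k + sgn j l) * X i l * X k j *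
    (partialDeriv f i j X * partialDeriv g k l X)

/-- The Hamiltonian vector field of `h`: its `(k, l)` component at `X` is `{x_{kl}, h}(X)`. -/
def hamiltonianField {n : ℕ} (h : Matrix (Fin n) (Fin n) ℂ → ℂ)
    (X : Matrix (Fin n) (Fin n) ℂ) : Matrix (Fin n) (Fin n) ℂ :=
  Matrix.of fun k l => poissonBracket (fun Y => Y k l) h X

/-- The Hamiltonian flow of `h` is complete over `ℂ`: through every point of `M_n` passes an
integral curve of the Hamiltonian vector field of `h` that is defined on the whole of `ℂ`. -/
def HasCompleteFlow {n : ℕ} (h : Matrix (Fin n) (Fin n) ℂ → ℂ) : Prop :=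
  ∀ X₀ : Matrix (Fin n) (Fin n) ℂ, ∃ γ : ℂ → Matrix (Fin n) (Fin n) ℂ,
    γ 0 = X₀ ∧ ∀ t : ℂ, HasDerivAt γ (hamiltonianField h (γ t)) t

/-- `Φ` is an analytic Hamiltonian action of the additive group `ℂ^N` on `(M_n, π_n)` whose
moment map has the components `μ 0, …, μ (N - 1)`. -/
structure IsAnalyticHamiltonianAction {n N : ℕ}
    (Φ : (Fin N → ℂ) → Matrix (Fin n) (Fin n) ℂ → Matrix (Fin n) (Fin n) ℂ)
    (μ : Fin N → Matrix (Fin n) (Fin n) ℂ → ℂ) : Prop where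
  /-- `Φ` is a group action of `ℂ^N`. -/
  zero_act : ∀ X, Φ 0 X = X
  add_act : ∀ v w X, Φ (v + w) X = Φ v (Φ w X)
  /-- The action map `ℂ^N × M_n → M_n` is (jointly, complex) analytic. -/
  analytic : AnalyticOnNhd ℂ
    (fun p : (Fin N → ℂ) × Matrix (Fin n) (Fin n) ℂ => Φ p.1 p.2) Set.univ
  /-- The moment map is analytic. -/
  moment_analytic : ∀ k, AnalyticOnNhd ℂ (μ k) Set.univ
  /-- The infinitesimal generator of `v` in the Lie algebra `ℂ^N` is the Hamiltonian vector field
  of the component `⟨μ, v⟩` of the moment map. -/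
  generator : ∀ (v : Fin N → ℂ) (X : Matrix (Fin n) (Fin n) ℂ),
    HasDerivAt (fun t : ℂ => Φ (t • v) X) (hamiltonianField (fun Y => ∑ k, v k * μ k Y) X) 0
  /-- `v ↦ ⟨μ, v⟩` is a homomorphism from the abelian Lie algebra `ℂ^N` to the Poisson algebra
  of functions. -/
  moment_hom : ∀ k l X, poissonBracket (μ k) (μ l) X = 0
  /-- The moment map is equivariant (the coadjoint action of `ℂ^N` is trivial). -/
  moment_equivariant : ∀ v k X, μ k (Φ v X) = μ k X

/-! ### The Kogan–Zelevinsky Hamiltonians -/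

/-- The minor `Δ_{I,J}(X)`: rows in `I`, columns in `J`, both in increasing order. -/
def minor {n : ℕ} (I J : Finset (Fin n)) (h : I.card = J.card)
    (X : Matrix (Fin n) (Fin n) ℂ) : ℂ :=
  (X.submatrix (I.orderEmbOfFin rfl) (J.orderEmbOfFin h.symm)).det

/-- The simple reflections of `S_n`. With the letters `0, …, n - 1`, the transposition of `i` and
`i + 1` is the reflection usually called `s_{i+1}`. -/
def simpleReflection {n : ℕ} (i : Fin (n - 1)) : Equiv.Perm (Fin n) :=
  Equiv.swap ⟨i, by omega⟩ ⟨i + 1, by omega⟩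

/-- `s_{j_1} ⋯ s_{j_m}`, the product of the first `m` simple reflections of a word. -/
def prefixProd {n N : ℕ} (j : Fin N → Fin (n - 1)) (m : ℕ) : Equiv.Perm (Fin n) :=
  ((List.ofFn fun k => simpleReflection (j k)).take m).prod

/-- `w_∘ = s_{j_1} ⋯ s_{j_{n(n-1)/2}}` is a reduced expression of the longest element `w_∘` of
`S_n`, the order-reversing permutation. The length of `w_∘` is `n(n-1)/2`, so an expression with
that number of factors is automatically reduced, and every reduced expression has this form. -/
def IsReducedExpression {n : ℕ} (j : Fin (n * (n - 1) / 2) → Fin (n - 1)) : Prop :=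
  prefixProd j (n * (n - 1) / 2) = Fin.revPerm

/-- The image `u[1, i]` under `u ∈ S_n` of the first letters; in the numbering from zero used here,
these are the letters `0, …, i`. -/
def imageInitial {n : ℕ} (u : Equiv.Perm (Fin n)) (i : Fin (n - 1)) : Finset (Fin n) :=
  (Finset.univ.filter fun a : Fin n => (a : ℕ) ≤ (i : ℕ)).map u.toEmbedding

/-- The Hamiltonian `H_k = Δ_{u_k[1, j_k], v_k[1, j_k]}` with `v_k = s_{j_1} ⋯ s_{j_{k-1}}` and
`u_k = w_∘⁻¹ v_k`. -/
def hamiltonian {n : ℕ} (j : Fin (n * (n - 1) / 2) → Fin (n - 1)) (k : Fin (n * (n - 1) / 2)) :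
    Matrix (Fin n) (Fin n) ℂ → ℂ :=
  minor (imageInitial ((Fin.revPerm : Equiv.Perm (Fin n))⁻¹ * prefixProd j k) (j k))
    (imageInitial (prefixProd j k) (j k))
    (by simp [imageInitial])

end KZ

end

/-!
The Hamiltonian vector field of `h` with gradient matrix `G` (`G l k = ∂h/∂x_{kl}`) is
`X ↦ S(XG) X - X S(GX)`, where `S` multiplies the `(i, k)` entry by `sign (k - i)`.

*Completeness.* Let `h = Δ` be the minor with rows `I` and columns `J`. The matrix `X G` vanishes in
the columns outside `I`, and its rows in `I` are those of `Δ • 1` (`IsRowScalar`); `G X` has the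
transposed shape. So the vector field does not change the `I × J` submatrix, and neither `Δ` nor
`G`, which depend on that submatrix only. The entries of `X G` and `G X` then satisfy scalar linear
equations with the constant coefficients `± Δ`, and products of two matrices of the form `S(XG)`
vanish. This integrates to `X(t) = (1 + P(t)) X (1 + Q(t))`, where the entries of `P(t)` and `Q(t)`
are those of `X G` and `G X` times the entire functions `∫₀ᵗ s e^{s Δ τ} dτ` with `s = 0, ± 1`
(`minorFlow`). This is analytic jointly in `t` and `X`, and satisfies the group law.

*Involution.* For two minors with gradients `G`, `G'`, the bracket is a sum of `sign (k - i)
(XG)_{ik} (XG')_{ki}` over rows minus the same kind of sum over columns. If the row sets and the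
column sets are separated (in opposite orders), the sign is `1` in every nonzero term off the
diagonal, and both sums are `tr (X G X G')` up to `ΔΔ'` times the number of common rows or columns
(`poissonBracket_minor_eq_zero`). For the minors at hand the row sets are the reversed column sets,
so these numbers agree. Separation comes from the word being reduced: the inversion sets of its
prefixes increase (`inversions_prefixProd_subset`).

*The action.* By the Jacobi identity, functions in involution have commuting Hamiltonian vector
fields (`commute_hamiltonianField`), hence commuting flows (`IsAnalyticFlow.commute`), and
the composite of the flows at the times `v_k` is the action.
-/

open Matrix
open scoped ContDiff

namespace KZ

variable {n p : ℕ}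

/-! ### Hamiltonian vector fields -/

theorem sgn_self (i : Fin n) : sgn i i = 0 := by simp [sgn]

theorem sgn_swap (i j : Fin n) : sgn j i = -sgn i j := by
  rw [sgn, sgn, ← neg_sub, Int.sign_neg]
  push_cast
  ring

theorem sgn_of_lt {i j : Fin n} (h : i < j) : sgn i j = 1 := by
  have : (0 : ℤ) < (j : ℤ) - (i : ℤ) := by
    have : (i : ℕ) < j := h
    omega
  simp [sgn, Int.sign_eq_one_of_pos this]

theorem hamiltonianField_apply (h : Matrix (Fin n) (Fin n) ℂ → ℂ) (X : Matrix (Fin n) (Fin n) ℂ)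
    (i j : Fin n) :
    hamiltonianField h X i j =
      ∑ k, ∑ l, (sgn i k + sgn j l) * X i l * X k j * partialDeriv h k l X := by
  have key : ∀ i' j', partialDeriv (fun Y : Matrix (Fin n) (Fin n) ℂ => Y i j) i' j' X =
      if i' = i ∧ j' = j then 1 else 0 := by
    intro i' j'
    have hd : HasFDerivAt (fun Y : Matrix (Fin n) (Fin n) ℂ => Y i j)
        (LinearMap.toContinuousLinearMap (Matrix.entryLinearMap ℂ ℂ i j)) X :=
      (LinearMap.toContinuousLinearMap
        (Matrix.entryLinearMap ℂ ℂ i j : Matrix (Fin n) (Fin n) ℂ →ₗ[ℂ] ℂ)).hasFDerivAt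
    rw [partialDeriv, hd.fderiv]
    simp [Matrix.single_apply]
  simp only [hamiltonianField, poissonBracket, Matrix.of_apply, key]
  rw [Finset.sum_eq_single i]
  · refine Finset.sum_congr rfl fun k _ => ?_
    rw [Finset.sum_eq_single j]
    · simp
    · intro b _ hb; simp [hb]
    · simp
  · intro b _ hb; simp [hb]
  · simp

/-- A continuous linear functional on matrices is determined by its values on matrix units. -/
theorem clm_apply_eq_sum (L : Matrix (Fin n) (Fin n) ℂ →L[ℂ] ℂ) (A : Matrix (Fin n) (Fin n) ℂ) :
    L A = ∑ i, ∑ j, A i j * L (Matrix.single i j 1) := by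
  conv_lhs => rw [Matrix.matrix_eq_sum_single A]
  simp only [map_sum]
  refine Finset.sum_congr rfl fun i _ => Finset.sum_congr rfl fun j _ => ?_
  rw [← smul_eq_mul, ← map_smul, Matrix.smul_single]
  simp

/-- The bracket `{f, h}` is the derivative of `f` along the Hamiltonian vector field of `h`. -/
theorem poissonBracket_eq_fderiv (f h : Matrix (Fin n) (Fin n) ℂ → ℂ)
    (X : Matrix (Fin n) (Fin n) ℂ) :
    poissonBracket f h X = fderiv ℂ f X (hamiltonianField h X) := by
  rw [clm_apply_eq_sum]
  simp only [poissonBracket, hamiltonianField_apply, Finset.sum_mul]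
  refine Finset.sum_congr rfl fun i _ => ?_
  rw [Finset.sum_comm]
  refine Finset.sum_congr rfl fun k _ => Finset.sum_congr rfl fun j _ =>
    Finset.sum_congr rfl fun l _ => ?_
  simp only [partialDeriv]
  ring

theorem hamiltonianField_sum {ι : Type*} (s : Finset ι) (v : ι → ℂ)
    (μ : ι → Matrix (Fin n) (Fin n) ℂ → ℂ) (hμ : ∀ k, Differentiable ℂ (μ k))
    (X : Matrix (Fin n) (Fin n) ℂ) :
    hamiltonianField (fun Y => ∑ k ∈ s, v k * μ k Y) X =
      ∑ k ∈ s, v k • hamiltonianField (μ k) X := by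
  have key : ∀ i j, partialDeriv (fun Y => ∑ k ∈ s, v k * μ k Y) i j X =
      ∑ k ∈ s, v k * partialDeriv (μ k) i j X := by
    intro i j
    have h : HasFDerivAt (fun Y => ∑ k ∈ s, v k * μ k Y)
        (∑ k ∈ s, v k • fderiv ℂ (μ k) X) X :=
      HasFDerivAt.fun_sum fun k _ => (hμ k X).hasFDerivAt.const_mul (v k)
    simp only [partialDeriv]
    refine (DFunLike.congr_fun h.fderiv (Matrix.single i j 1)).trans ?_
    simp
  ext i j
  rw [hamiltonianField_apply, Matrix.sum_apply]
  simp only [Matrix.smul_apply, hamiltonianField_apply, key, smul_eq_mul, Finset.mul_sum]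
  symm
  rw [Finset.sum_comm]
  refine Finset.sum_congr rfl fun k _ => ?_
  rw [Finset.sum_comm]
  refine Finset.sum_congr rfl fun l _ => Finset.sum_congr rfl fun m _ => ?_
  ring

/-! ### Gradients of minors -/

/-- The gradient of the minor `X ↦ det (X.submatrix r c)`: its `(l, k)` entry is the partial
derivative with respect to `x_{kl}`. It is the adjugate of the submatrix, put back into the columns
`r` and the rows `c`. -/
noncomputable def minorGrad (r c : Fin p → Fin n) (X : Matrix (Fin n) (Fin n) ℂ) :
    Matrix (Fin n) (Fin n) ℂ :=
  (1 : Matrix (Fin n) (Fin n) ℂ).submatrix id c * (X.submatrix r c).adjugate *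
    (1 : Matrix (Fin n) (Fin n) ℂ).submatrix r id

theorem minorGrad_apply (r c : Fin p → Fin n) (X : Matrix (Fin n) (Fin n) ℂ) (l k : Fin n) :
    minorGrad r c X l k = ∑ a, ∑ b, (if l = c b then 1 else 0) *
      (X.submatrix r c).adjugate b a * (if r a = k then 1 else 0) := by
  simp [minorGrad, Matrix.mul_apply, Matrix.one_apply]

theorem contDiff_entry (i j : Fin n) :
    ContDiff ℂ ω (fun X : Matrix (Fin n) (Fin n) ℂ => X i j) :=
  (LinearMap.toContinuousLinearMap
    (Matrix.entryLinearMap ℂ ℂ i j : Matrix (Fin n) (Fin n) ℂ →ₗ[ℂ] ℂ)).contDiff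

section ContDiff

variable {E : Type*} [NormedAddCommGroup E] [NormedSpace ℂ E] {m : WithTop ℕ∞}

theorem contDiff_det {f : E → Matrix (Fin p) (Fin p) ℂ}
    (hf : ∀ i j, ContDiff ℂ m fun x => f x i j) : ContDiff ℂ m fun x => (f x).det := by
  simp only [Matrix.det_apply']
  exact ContDiff.sum fun σ _ => contDiff_const.mul (contDiff_prod fun i _ => hf _ _)

theorem contDiff_adjugate {f : E → Matrix (Fin p) (Fin p) ℂ}
    (hf : ∀ i j, ContDiff ℂ m fun x => f x i j) (a b : Fin p) :
    ContDiff ℂ m fun x => (f x).adjugate a b := by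
  simp only [Matrix.adjugate_apply]
  refine contDiff_det fun i j => ?_
  by_cases h : i = b
  · subst h
    simpa using contDiff_const
  · simpa [Matrix.updateRow_ne h] using hf i j

theorem contDiff_mul_entry {f g : E → Matrix (Fin n) (Fin n) ℂ}
    (hf : ∀ i j, ContDiff ℂ m fun x => f x i j) (hg : ∀ i j, ContDiff ℂ m fun x => g x i j)
    (i j : Fin n) : ContDiff ℂ m fun x => (f x * g x) i j := by
  simp only [Matrix.mul_apply]
  exact ContDiff.sum fun k _ => (hf _ _).mul (hg _ _)

end ContDiff

theorem contDiff_minor (r c : Fin p → Fin n) :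
    ContDiff ℂ ω fun X : Matrix (Fin n) (Fin n) ℂ => (X.submatrix r c).det :=
  contDiff_det fun _ _ => contDiff_entry _ _

theorem contDiff_minorGrad (r c : Fin p → Fin n) (l k : Fin n) :
    ContDiff ℂ ω fun X : Matrix (Fin n) (Fin n) ℂ => minorGrad r c X l k := by
  simp only [minorGrad_apply]
  exact ContDiff.sum fun a _ => ContDiff.sum fun b _ =>
    (contDiff_const.mul (contDiff_adjugate (fun _ _ => contDiff_entry _ _) b a)).mul contDiff_const

theorem det_add_smul_single (M : Matrix (Fin p) (Fin p) ℂ) (a b : Fin p) (t : ℂ) :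
    (M + t • Matrix.single a b 1).det = M.det + t * M.adjugate b a := by
  have : M + t • Matrix.single a b 1 = M.updateRow a (M a + t • Pi.single b 1) := by
    ext i j
    by_cases h : i = a
    · subst h
      simp [Matrix.single_apply, Pi.single_apply, eq_comm]
    · simp [Matrix.updateRow_ne h, Ne.symm h]
  rw [this, Matrix.det_updateRow_add, Matrix.det_updateRow_smul, Matrix.adjugate_apply,
    Matrix.updateRow_eq_self]

theorem partialDeriv_minor {r c : Fin p → Fin n} (hr : r.Injective) (hc : c.Injective)
    (X : Matrix (Fin n) (Fin n) ℂ) (k l : Fin n) :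
    partialDeriv (fun Y => (Y.submatrix r c).det) k l X = minorGrad r c X l k := by
  have hline : HasDerivAt (fun t : ℂ => X + t • Matrix.single k l (1 : ℂ))
      (Matrix.single k l 1) 0 := by
    have h := ((hasDerivAt_id (0 : ℂ)).smul_const (Matrix.single k l (1 : ℂ))).const_add X
    rwa [one_smul] at h
  have hd : HasFDerivAt (fun Y : Matrix (Fin n) (Fin n) ℂ => (Y.submatrix r c).det)
      (fderiv ℂ (fun Y : Matrix (Fin n) (Fin n) ℂ => (Y.submatrix r c).det) X)
      (X + (0 : ℂ) • Matrix.single k l (1 : ℂ)) := by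
    rw [zero_smul, add_zero]
    exact ((contDiff_minor r c).differentiable (by simp) X).hasFDerivAt
  have h1 := hd.comp_hasDerivAt (0 : ℂ) hline
  refine h1.deriv.symm.trans ?_
  by_cases hk : ∃ a, r a = k
  · by_cases hl : ∃ b, c b = l
    · obtain ⟨a, rfl⟩ := hk
      obtain ⟨b, rfl⟩ := hl
      have h2 : ∀ t : ℂ, (X + t • Matrix.single (r a) (c b) (1 : ℂ)).submatrix r c =
          X.submatrix r c + t • Matrix.single a b 1 := by
        intro t
        ext i j
        simp [Matrix.single_apply, hr.eq_iff, hc.eq_iff]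
      have h3 : ((fun Y : Matrix (Fin n) (Fin n) ℂ => (Y.submatrix r c).det) ∘
          fun t : ℂ => X + t • Matrix.single (r a) (c b) (1 : ℂ)) =
          fun t => (X.submatrix r c).det + t * (X.submatrix r c).adjugate b a := by
        funext t
        simp only [Function.comp_apply, h2, det_add_smul_single]
      rw [h3, minorGrad_apply]
      have h4 : HasDerivAt (fun t : ℂ => (X.submatrix r c).det + t * (X.submatrix r c).adjugate b a)
          ((X.submatrix r c).adjugate b a) 0 := by
        simpa using ((hasDerivAt_id (0 : ℂ)).mul_const
          ((X.submatrix r c).adjugate b a)).const_add (X.submatrix r c).det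
      rw [h4.deriv]
      simp [hr.eq_iff, hc.eq_iff]
    · have h3 : ((fun Y : Matrix (Fin n) (Fin n) ℂ => (Y.submatrix r c).det) ∘
          fun t : ℂ => X + t • Matrix.single k l (1 : ℂ)) = fun t => (X.submatrix r c).det := by
        funext t
        refine congrArg Matrix.det ?_
        ext i j
        have : l ≠ c j := fun h => hl ⟨j, h.symm⟩
        simp [this]
      have h5 : ∀ b, l ≠ c b := fun b h => hl ⟨b, h.symm⟩
      rw [h3, minorGrad_apply]
      simp [h5]
  · have h3 : ((fun Y : Matrix (Fin n) (Fin n) ℂ => (Y.submatrix r c).det) ∘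
          fun t : ℂ => X + t • Matrix.single k l (1 : ℂ)) = fun t => (X.submatrix r c).det := by
        funext t
        refine congrArg Matrix.det ?_
        ext i j
        have : k ≠ r i := fun h => hk ⟨i, h.symm⟩
        simp [this]
    have h5 : ∀ a, r a ≠ k := fun a h => hk ⟨a, h⟩
    rw [h3, minorGrad_apply]
    simp [h5]

theorem minorGrad_eq_zero_of_row {r c : Fin p → Fin n} {X : Matrix (Fin n) (Fin n) ℂ} {l : Fin n}
    (hl : l ∉ Set.range c) (k : Fin n) : minorGrad r c X l k = 0 := by
  have : ∀ b, l ≠ c b := fun b h => hl ⟨b, h.symm⟩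
  simp [minorGrad_apply, this]

theorem minorGrad_eq_zero_of_col {r c : Fin p → Fin n} {X : Matrix (Fin n) (Fin n) ℂ} {k : Fin n}
    (hk : k ∉ Set.range r) (l : Fin n) : minorGrad r c X l k = 0 := by
  have : ∀ a, r a ≠ k := fun a h => hk ⟨a, h⟩
  simp [minorGrad_apply, this]

/-- The shape of the matrix `B = X * ∇Δ`, for a minor `Δ` with rows `I` and value `δ`: the columns
outside `I` vanish, and the rows in `I` are those of `δ • 1`. The transpose of `∇Δ * X` has the same
shape, for the set of columns of the minor. -/
structure IsRowScalar (I : Set (Fin n)) (δ : ℂ) (B : Matrix (Fin n) (Fin n) ℂ) : Prop where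
  col_eq_zero : ∀ i k, k ∉ I → B i k = 0
  row_eq : ∀ i k, i ∈ I → B i k = if i = k then δ else 0

theorem isRowScalar_mul_minorGrad (r c : Fin p → Fin n)
    (X : Matrix (Fin n) (Fin n) ℂ) :
    IsRowScalar (Set.range r) (X.submatrix r c).det (X * minorGrad r c X) where
  col_eq_zero i k hk := by
    simp [Matrix.mul_apply, minorGrad_eq_zero_of_col hk]
  row_eq := by
    rintro _ k ⟨a, rfl⟩
    have h1 : (X * minorGrad r c X).submatrix r id =
        (X.submatrix r c).det • (1 : Matrix (Fin n) (Fin n) ℂ).submatrix r id := by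
      have h2 : (X * minorGrad r c X).submatrix r id =
          X.submatrix r c * (X.submatrix r c).adjugate *
            (1 : Matrix (Fin n) (Fin n) ℂ).submatrix r id := by
        rw [minorGrad, ← Matrix.mul_assoc, ← Matrix.mul_assoc]
        have : X.submatrix r c = X.submatrix r id *
            (1 : Matrix (Fin n) (Fin n) ℂ).submatrix id c := by
          ext i j; simp [Matrix.mul_apply, Matrix.one_apply]
        conv_rhs => rw [show X.submatrix r c * (X.submatrix r c).adjugate =
          X.submatrix r id * (1 : Matrix (Fin n) (Fin n) ℂ).submatrix id c *
            (X.submatrix r c).adjugate by rw [← this]]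
        rfl
      rw [h2, Matrix.mul_adjugate, Matrix.smul_mul, Matrix.one_mul]
    have h3 := congrFun (congrFun h1 a) k
    simpa [Matrix.one_apply] using h3

theorem isRowScalar_minorGrad_mul (r c : Fin p → Fin n)
    (X : Matrix (Fin n) (Fin n) ℂ) :
    IsRowScalar (Set.range c) (X.submatrix r c).det (minorGrad r c X * X)ᵀ := by
  have h : minorGrad c r Xᵀ = (minorGrad r c X)ᵀ := by
    rw [minorGrad, minorGrad, Matrix.transpose_mul, Matrix.transpose_mul, Matrix.adjugate_transpose,
      Matrix.mul_assoc]
    simp [Matrix.transpose_submatrix]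
  have h2 := isRowScalar_mul_minorGrad c r Xᵀ
  rwa [h, ← Matrix.transpose_mul, ← Matrix.transpose_submatrix, Matrix.det_transpose] at h2

/-! ### The Hamiltonian flow of a minor -/

/-- The entire function `∫₀ᵗ s e^{s δ τ} dτ`, that is, `(e^{s δ t} - 1) / δ` extended over
`δ = 0`. -/
noncomputable def expIntegral (s δ t : ℂ) : ℂ := s * t * dslope Complex.exp 0 (s * δ * t)

@[simp] theorem expIntegral_zero_left (δ t : ℂ) : expIntegral 0 δ t = 0 := by simp [expIntegral]

@[simp] theorem expIntegral_zero_right (s δ : ℂ) : expIntegral s δ 0 = 0 := by simp [expIntegral]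

theorem mul_expIntegral (s δ t : ℂ) : δ * expIntegral s δ t = Complex.exp (s * δ * t) - 1 := by
  have h := sub_smul_dslope Complex.exp 0 (s * δ * t)
  rw [Complex.exp_zero, sub_zero, smul_eq_mul] at h
  rw [← h, expIntegral]
  ring

theorem expIntegral_of_eq_zero (s t : ℂ) : expIntegral s 0 t = s * t := by
  simp [expIntegral]

theorem expIntegral_of_ne_zero (s t : ℂ) {δ : ℂ} (h : δ ≠ 0) :
    expIntegral s δ t = (Complex.exp (s * δ * t) - 1) / δ := by
  rw [← mul_expIntegral, mul_div_cancel_left₀ _ h]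

theorem expIntegral_add (s δ t u : ℂ) :
    expIntegral s δ (t + u) = expIntegral s δ u + Complex.exp (s * δ * u) * expIntegral s δ t := by
  by_cases h : δ = 0
  · subst h
    simp [expIntegral_of_eq_zero]
    ring
  · simp only [expIntegral_of_ne_zero s _ h, mul_add, Complex.exp_add]
    field_simp
    ring

theorem hasDerivAt_expIntegral_zero (s δ : ℂ) : HasDerivAt (expIntegral s δ) s 0 := by
  by_cases h : δ = 0
  · subst h
    have : expIntegral s 0 = fun t => s * t := funext (expIntegral_of_eq_zero s)
    rw [this]
    simpa using (hasDerivAt_id (0 : ℂ)).const_mul s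
  · have : expIntegral s δ = fun t => (Complex.exp (s * δ * t) - 1) / δ :=
      funext fun t => expIntegral_of_ne_zero s t h
    rw [this]
    have h1 := ((((hasDerivAt_id (0 : ℂ)).const_mul (s * δ)).cexp).sub_const 1).div_const δ
    refine h1.congr_deriv ?_
    simp [h]

theorem contDiff_dslope_exp : ContDiff ℂ ω (dslope Complex.exp 0) := by
  have h : DifferentiableOn ℂ (dslope Complex.exp 0) Set.univ :=
    (Complex.differentiableOn_dslope Filter.univ_mem).2 Complex.differentiable_exp.differentiableOn
  exact (h.analyticOnNhd isOpen_univ).contDiff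

theorem contDiff_expIntegral {E : Type*} [NormedAddCommGroup E] [NormedSpace ℂ E] (s : ℂ)
    {f g : E → ℂ} (hf : ContDiff ℂ ω f) (hg : ContDiff ℂ ω g) :
    ContDiff ℂ ω fun x => expIntegral s (f x) (g x) :=
  (contDiff_const.mul hg).mul (contDiff_dslope_exp.comp ((contDiff_const.mul hf).mul hg))

namespace IsRowScalar

variable {I : Set (Fin n)} {δ : ℂ} {B : Matrix (Fin n) (Fin n) ℂ}

theorem hadamard_apply_eq_zero (h : IsRowScalar I δ B) {W : Matrix (Fin n) (Fin n) ℂ}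
    (hW : ∀ i, W i i = 0) {i : Fin n} (hi : i ∈ I) (k : Fin n) : (W ⊙ B) i k = 0 := by
  rw [hadamard_apply, h.row_eq i k hi]
  split_ifs with hik
  · rw [← hik, hW, zero_mul]
  · rw [mul_zero]

theorem hadamard_mul_hadamard (h : IsRowScalar I δ B) (V : Matrix (Fin n) (Fin n) ℂ)
    {W : Matrix (Fin n) (Fin n) ℂ} (hW : ∀ i, W i i = 0) : (V ⊙ B) * (W ⊙ B) = 0 := by
  ext i j
  rw [Matrix.mul_apply, Matrix.zero_apply]
  refine Finset.sum_eq_zero fun k _ => ?_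
  by_cases hk : k ∈ I
  · rw [h.hadamard_apply_eq_zero hW hk, mul_zero]
  · rw [hadamard_apply, h.col_eq_zero i k hk, mul_zero, zero_mul]

theorem hadamard_mul (h : IsRowScalar I δ B) (V : Matrix (Fin n) (Fin n) ℂ) :
    (V ⊙ B) * B = δ • (V ⊙ B) := by
  ext i j
  rw [Matrix.mul_apply, Finset.sum_eq_single j]
  · by_cases hj : j ∈ I
    · simp [h.row_eq j j hj, mul_comm]
    · simp [h.col_eq_zero _ j hj]
  · intro k _ hkj
    by_cases hk : k ∈ I
    · simp [h.row_eq k j hk, hkj]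
    · simp [h.col_eq_zero i k hk]
  · simp

end IsRowScalar

section Flow

variable (r c : Fin p → Fin n)

/-- The left factor, besides `1`, of the flow of the minor with rows `r` and columns `c`. -/
noncomputable def flowLeft (t : ℂ) (X : Matrix (Fin n) (Fin n) ℂ) : Matrix (Fin n) (Fin n) ℂ :=
  Matrix.of (fun i k => expIntegral (sgn i k) (X.submatrix r c).det t) ⊙ (X * minorGrad r c X)

/-- The right factor, besides `1`, of the flow of the minor with rows `r` and columns `c`. -/
noncomputable def flowRight (t : ℂ) (X : Matrix (Fin n) (Fin n) ℂ) : Matrix (Fin n) (Fin n) ℂ :=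
  Matrix.of (fun l j => expIntegral (sgn j l) (X.submatrix r c).det t) ⊙ (minorGrad r c X * X)

/-- The Hamiltonian flow of the minor `X ↦ det (X.submatrix r c)` in closed form. -/
noncomputable def minorFlow (t : ℂ) (X : Matrix (Fin n) (Fin n) ℂ) : Matrix (Fin n) (Fin n) ℂ :=
  (1 + flowLeft r c t X) * X * (1 + flowRight r c t X)

variable {r c}

theorem flowLeft_apply_eq_zero (t : ℂ) (X : Matrix (Fin n) (Fin n) ℂ) (a : Fin p) (k : Fin n) :
    flowLeft r c t X (r a) k = 0 :=
  (isRowScalar_mul_minorGrad r c X).hadamard_apply_eq_zero (by simp [sgn_self]) ⟨a, rfl⟩ k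

theorem transpose_flowRight (t : ℂ) (X : Matrix (Fin n) (Fin n) ℂ) :
    (flowRight r c t X)ᵀ =
      Matrix.of (fun j l => expIntegral (sgn j l) (X.submatrix r c).det t) ⊙
        (minorGrad r c X * X)ᵀ := rfl

theorem flowRight_apply_eq_zero (t : ℂ) (X : Matrix (Fin n) (Fin n) ℂ) (l : Fin n) (b : Fin p) :
    flowRight r c t X l (c b) = 0 := by
  rw [← Matrix.transpose_apply (flowRight r c t X), transpose_flowRight]
  exact (isRowScalar_minorGrad_mul r c X).hadamard_apply_eq_zero (by simp [sgn_self]) ⟨b, rfl⟩ l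

theorem minorGrad_mul_flowLeft (t : ℂ) (X : Matrix (Fin n) (Fin n) ℂ) :
    minorGrad r c X * flowLeft r c t X = 0 := by
  ext i j
  rw [Matrix.mul_apply, Matrix.zero_apply]
  refine Finset.sum_eq_zero fun k _ => ?_
  by_cases hk : k ∈ Set.range r
  · obtain ⟨a, rfl⟩ := hk
    rw [flowLeft_apply_eq_zero, mul_zero]
  · rw [minorGrad_eq_zero_of_col hk, zero_mul]

theorem flowRight_mul_minorGrad (t : ℂ) (X : Matrix (Fin n) (Fin n) ℂ) :
    flowRight r c t X * minorGrad r c X = 0 := by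
  ext i j
  rw [Matrix.mul_apply, Matrix.zero_apply]
  refine Finset.sum_eq_zero fun k _ => ?_
  by_cases hk : k ∈ Set.range c
  · obtain ⟨a, rfl⟩ := hk
    rw [flowRight_apply_eq_zero, zero_mul]
  · rw [minorGrad_eq_zero_of_row hk, mul_zero]

/-- The flow of a minor fixes every entry of the submatrix of that minor. -/
theorem submatrix_minorFlow (t : ℂ) (X : Matrix (Fin n) (Fin n) ℂ) :
    (minorFlow r c t X).submatrix r c = X.submatrix r c := by
  have h1 : ∀ Z : Matrix (Fin n) (Fin n) ℂ, ∀ a j,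
      ((1 + flowLeft r c t X) * Z) (r a) j = Z (r a) j := by
    intro Z a j
    rw [Matrix.add_mul, Matrix.one_mul, Matrix.add_apply, Matrix.mul_apply]
    simp [flowLeft_apply_eq_zero]
  have h2 : ∀ Z : Matrix (Fin n) (Fin n) ℂ, ∀ i b,
      (Z * (1 + flowRight r c t X)) i (c b) = Z i (c b) := by
    intro Z i b
    rw [Matrix.mul_add, Matrix.mul_one, Matrix.add_apply, Matrix.mul_apply]
    simp [flowRight_apply_eq_zero]
  ext a b
  rw [Matrix.submatrix_apply, Matrix.submatrix_apply, minorFlow, h2, h1]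

theorem minorGrad_minorFlow (t : ℂ) (X : Matrix (Fin n) (Fin n) ℂ) :
    minorGrad r c (minorFlow r c t X) = minorGrad r c X := by
  simp only [minorGrad, submatrix_minorFlow]

/-- Along the flow the entries of `X * ∇Δ` only change by exponential factors. -/
theorem minorFlow_mul_minorGrad (t : ℂ) (X : Matrix (Fin n) (Fin n) ℂ) :
    minorFlow r c t X * minorGrad r c X =
      Matrix.of (fun i k => Complex.exp (sgn i k * (X.submatrix r c).det * t)) ⊙
        (X * minorGrad r c X) := by
  have h := (isRowScalar_mul_minorGrad r c X).hadamard_mul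
    (Matrix.of fun i k => expIntegral (sgn i k) (X.submatrix r c).det t)
  rw [minorFlow, Matrix.mul_assoc, Matrix.add_mul 1 (flowRight r c t X), flowRight_mul_minorGrad,
    add_zero, Matrix.one_mul, Matrix.mul_assoc, Matrix.add_mul, Matrix.one_mul, flowLeft, h]
  ext i k
  have h2 := mul_expIntegral (sgn i k) (X.submatrix r c).det t
  simp only [Matrix.add_apply, Matrix.smul_apply, hadamard_apply, Matrix.of_apply, smul_eq_mul]
  rw [← mul_assoc, h2]
  ring

theorem minorGrad_mul_minorFlow (t : ℂ) (X : Matrix (Fin n) (Fin n) ℂ) :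
    minorGrad r c X * minorFlow r c t X =
      Matrix.of (fun l j => Complex.exp (sgn j l * (X.submatrix r c).det * t)) ⊙
        (minorGrad r c X * X) := by
  have h := (isRowScalar_minorGrad_mul r c X).hadamard_mul
    (Matrix.of fun i k => expIntegral (sgn i k) (X.submatrix r c).det t)
  rw [← transpose_flowRight, ← Matrix.transpose_mul, ← Matrix.transpose_smul,
    Matrix.transpose_inj] at h
  rw [minorFlow, ← Matrix.mul_assoc, ← Matrix.mul_assoc, Matrix.mul_add _ 1 (flowLeft r c t X),
    minorGrad_mul_flowLeft, add_zero, Matrix.mul_one, Matrix.mul_add, Matrix.mul_one, h, flowRight]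
  ext i k
  have h2 := mul_expIntegral (sgn k i) (X.submatrix r c).det t
  simp only [Matrix.add_apply, Matrix.smul_apply, hadamard_apply, Matrix.of_apply, smul_eq_mul]
  rw [← mul_assoc, h2]
  ring

@[simp] theorem minorFlow_zero (X : Matrix (Fin n) (Fin n) ℂ) : minorFlow r c 0 X = X := by
  have h1 : flowLeft r c 0 X = 0 := by ext; simp [flowLeft]
  have h2 : flowRight r c 0 X = 0 := by ext; simp [flowRight]
  simp [minorFlow, h1, h2]

theorem minorFlow_add (t u : ℂ) (X : Matrix (Fin n) (Fin n) ℂ) :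
    minorFlow r c (t + u) X = minorFlow r c t (minorFlow r c u X) := by
  have hl : (1 + flowLeft r c t (minorFlow r c u X)) * (1 + flowLeft r c u X) =
      1 + flowLeft r c (t + u) X := by
    have h1 : flowLeft r c t (minorFlow r c u X) =
        Matrix.of (fun i k => expIntegral (sgn i k) (X.submatrix r c).det t *
          Complex.exp (sgn i k * (X.submatrix r c).det * u)) ⊙ (X * minorGrad r c X) := by
      rw [flowLeft, minorGrad_minorFlow, minorFlow_mul_minorGrad, submatrix_minorFlow]
      ext i k
      simp only [hadamard_apply, Matrix.of_apply]
      ring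
    have h2 : flowLeft r c t (minorFlow r c u X) * flowLeft r c u X = 0 := by
      rw [h1]
      exact (isRowScalar_mul_minorGrad r c X).hadamard_mul_hadamard _ (by simp [sgn_self])
    have h3 : flowLeft r c (t + u) X =
        flowLeft r c t (minorFlow r c u X) + flowLeft r c u X := by
      rw [h1]
      ext i k
      simp only [flowLeft, Matrix.add_apply, hadamard_apply, Matrix.of_apply, expIntegral_add]
      ring
    rw [h3, Matrix.mul_add, Matrix.mul_one, Matrix.add_mul, Matrix.one_mul, h2]
    abel
  have hr : (1 + flowRight r c u X) * (1 + flowRight r c t (minorFlow r c u X)) =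
      1 + flowRight r c (t + u) X := by
    have h1 : flowRight r c t (minorFlow r c u X) =
        Matrix.of (fun l j => expIntegral (sgn j l) (X.submatrix r c).det t *
          Complex.exp (sgn j l * (X.submatrix r c).det * u)) ⊙ (minorGrad r c X * X) := by
      rw [flowRight, minorGrad_minorFlow, minorGrad_mul_minorFlow, submatrix_minorFlow]
      ext i k
      simp only [hadamard_apply, Matrix.of_apply]
      ring
    have h2 : flowRight r c u X * flowRight r c t (minorFlow r c u X) = 0 := by
      rw [← Matrix.transpose_inj, Matrix.transpose_mul, h1, transpose_flowRight,
        Matrix.transpose_zero]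
      exact (isRowScalar_minorGrad_mul r c X).hadamard_mul_hadamard
        (Matrix.of fun j l => expIntegral (sgn j l) (X.submatrix r c).det t *
          Complex.exp (sgn j l * (X.submatrix r c).det * u)) (by simp [sgn_self])
    have h3 : flowRight r c (t + u) X =
        flowRight r c t (minorFlow r c u X) + flowRight r c u X := by
      rw [h1]
      ext i k
      simp only [flowRight, Matrix.add_apply, hadamard_apply, Matrix.of_apply, expIntegral_add]
      ring
    rw [h3, Matrix.mul_add, Matrix.mul_one, Matrix.add_mul, Matrix.one_mul, h2]
    abel
  rw [minorFlow, ← hl, ← hr]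
  conv_rhs => rw [minorFlow]
  conv_rhs => enter [1, 2]; rw [minorFlow]
  simp only [Matrix.mul_assoc]

theorem contDiff_minorFlow :
    ContDiff ℂ ω fun q : ℂ × Matrix (Fin n) (Fin n) ℂ => minorFlow r c q.1 q.2 := by
  have hX : ∀ i j, ContDiff ℂ ω fun q : ℂ × Matrix (Fin n) (Fin n) ℂ => q.2 i j :=
    fun i j => (contDiff_entry i j).comp contDiff_snd
  have hG : ∀ i j, ContDiff ℂ ω fun q : ℂ × Matrix (Fin n) (Fin n) ℂ =>
      minorGrad r c q.2 i j := fun i j => (contDiff_minorGrad r c i j).comp contDiff_snd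
  have hδ : ContDiff ℂ ω fun q : ℂ × Matrix (Fin n) (Fin n) ℂ => (q.2.submatrix r c).det :=
    (contDiff_minor r c).comp contDiff_snd
  refine contDiff_pi' fun i => contDiff_pi' fun j => ?_
  refine contDiff_mul_entry (contDiff_mul_entry (fun i k => ?_) hX) (fun i k => ?_) i j
  · simp only [flowLeft, Matrix.add_apply, hadamard_apply, Matrix.of_apply]
    exact contDiff_const.add
      ((contDiff_expIntegral _ hδ contDiff_fst).mul (contDiff_mul_entry hX hG i k))
  · simp only [flowRight, Matrix.add_apply, hadamard_apply, Matrix.of_apply]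
    exact contDiff_const.add
      ((contDiff_expIntegral _ hδ contDiff_fst).mul (contDiff_mul_entry hG hX i k))

/-- The Hamiltonian vector field in terms of the gradient matrix `G`. -/
theorem hamiltonianField_eq (h : Matrix (Fin n) (Fin n) ℂ → ℂ) (X G : Matrix (Fin n) (Fin n) ℂ)
    (hG : ∀ k l, partialDeriv h k l X = G l k) :
    hamiltonianField h X = (Matrix.of (fun i k => sgn i k) ⊙ (X * G)) * X +
      X * (Matrix.of (fun l j => sgn j l) ⊙ (G * X)) := by
  ext i j
  simp only [hamiltonianField_apply, hG, Matrix.add_apply, Matrix.mul_apply, hadamard_apply,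
    Matrix.of_apply, Finset.mul_sum, Finset.sum_mul]
  rw [Finset.sum_comm' (t' := Finset.univ) (s' := fun _ => Finset.univ) (by simp)
    (f := fun l k => X i l * (sgn j l * (G l k * X k j))), ← Finset.sum_add_distrib]
  refine Finset.sum_congr rfl fun k _ => ?_
  rw [← Finset.sum_add_distrib]
  refine Finset.sum_congr rfl fun l _ => ?_
  ring

theorem hasDerivAt_mul_entry {A B : ℂ → Matrix (Fin n) (Fin n) ℂ}
    {A' B' : Matrix (Fin n) (Fin n) ℂ} {t : ℂ}
    (hA : ∀ i j, HasDerivAt (fun t => A t i j) (A' i j) t)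
    (hB : ∀ i j, HasDerivAt (fun t => B t i j) (B' i j) t) (i j : Fin n) :
    HasDerivAt (fun t => (A t * B t) i j) ((A' * B t + A t * B') i j) t := by
  simp only [Matrix.add_apply, Matrix.mul_apply, ← Finset.sum_add_distrib]
  exact HasDerivAt.fun_sum fun k _ => (hA i k).mul (hB k j)

theorem hasDerivAt_minorFlow_zero (hr : r.Injective) (hc : c.Injective)
    (X : Matrix (Fin n) (Fin n) ℂ) :
    HasDerivAt (fun t => minorFlow r c t X)
      (hamiltonianField (fun Y => (Y.submatrix r c).det) X) 0 := by
  rw [hamiltonianField_eq _ X (minorGrad r c X) fun k l => partialDeriv_minor hr hc X k l]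
  refine hasDerivAt_pi.2 fun i => hasDerivAt_pi.2 fun j => ?_
  have hL : ∀ i k, HasDerivAt (fun t => (1 + flowLeft r c t X) i k)
      ((Matrix.of (fun i k => sgn i k) ⊙ (X * minorGrad r c X)) i k) 0 := by
    intro i k
    simp only [flowLeft, Matrix.add_apply, hadamard_apply, Matrix.of_apply]
    exact ((hasDerivAt_expIntegral_zero _ _).mul_const _).const_add _
  have hR : ∀ i k, HasDerivAt (fun t => (1 + flowRight r c t X) i k)
      ((Matrix.of (fun l j => sgn j l) ⊙ (minorGrad r c X * X)) i k) 0 := by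
    intro i k
    simp only [flowRight, Matrix.add_apply, hadamard_apply, Matrix.of_apply]
    exact ((hasDerivAt_expIntegral_zero _ _).mul_const _).const_add _
  have h1 : flowLeft r c 0 X = 0 := by ext; simp [flowLeft]
  have h2 : flowRight r c 0 X = 0 := by ext; simp [flowRight]
  have h := hasDerivAt_mul_entry (hasDerivAt_mul_entry hL
    (B := fun _ => X) (B' := 0) fun i j => hasDerivAt_const _ _) hR i j
  refine HasDerivAt.congr_deriv h ?_
  simp [h1, h2]

end Flow

/-! ### Commuting analytic flows -/

section Composition

variable {E ι : Type*} {φ : ι → ℂ → E → E}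

/-- The composite of the maps `φ k (v k)`, for `k` in the list `l`. -/
def composeFlows (φ : ι → ℂ → E → E) (l : List ι) (v : ι → ℂ) (x : E) : E :=
  l.foldr (fun k y => φ k (v k) y) x

theorem apply_composeFlows (hc : ∀ k l s t x, φ k s (φ l t x) = φ l t (φ k s x)) (k : ι) (s : ℂ)
    (l : List ι) (v : ι → ℂ) (x : E) :
    φ k s (composeFlows φ l v x) = composeFlows φ l v (φ k s x) := by
  induction l with
  | nil => rfl
  | cons m l ih =>
    change φ k s (φ m (v m) (composeFlows φ l v x)) = φ m (v m) (composeFlows φ l v (φ k s x))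
    rw [hc, ih]

theorem composeFlows_invariant {f : E → ℂ} (hf : ∀ k t x, f (φ k t x) = f x) (l : List ι)
    (v : ι → ℂ) (x : E) : f (composeFlows φ l v x) = f x := by
  induction l with
  | nil => rfl
  | cons k l ih => exact (hf k (v k) _).trans ih

end Composition

section Flows

variable {E : Type*} [NormedAddCommGroup E] [NormedSpace ℂ E]

/-- `φ` is a complete flow over `ℂ`, analytic jointly in time and position, of the vector field
`V`. -/
structure IsAnalyticFlow (φ : ℂ → E → E) (V : E → E) : Prop where
  zero_apply : ∀ x, φ 0 x = x
  add_apply : ∀ s t x, φ (s + t) x = φ s (φ t x)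
  contDiff : ContDiff ℂ ω fun q : ℂ × E => φ q.1 q.2
  hasDerivAt_zero : ∀ x, HasDerivAt (fun t => φ t x) (V x) 0

namespace IsAnalyticFlow

variable {φ ψ : ℂ → E → E} {V W : E → E}

theorem hasDerivAt (h : IsAnalyticFlow φ V) (t : ℂ) (x : E) :
    HasDerivAt (fun s => φ s x) (V (φ t x)) t := by
  have h1 : (fun s => φ s x) = fun s => φ (s - t) (φ t x) := by
    funext s
    rw [← h.add_apply, sub_add_cancel]
  rw [h1]
  refine HasDerivAt.comp_sub_const (f := fun s => φ s (φ t x)) t t ?_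
  rw [sub_self]
  exact h.hasDerivAt_zero _

theorem neg_apply_apply (h : IsAnalyticFlow φ V) (t : ℂ) (x : E) : φ (-t) (φ t x) = x := by
  rw [← h.add_apply, neg_add_cancel, h.zero_apply]

theorem apply_neg_apply (h : IsAnalyticFlow φ V) (t : ℂ) (x : E) : φ t (φ (-t) x) = x := by
  rw [← h.add_apply, add_neg_cancel, h.zero_apply]

theorem hasFDerivAt (h : IsAnalyticFlow φ V) (q : ℂ × E) :
    HasFDerivAt (fun q : ℂ × E => φ q.1 q.2) (fderiv ℂ (fun q : ℂ × E => φ q.1 q.2) q) q :=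
  (h.contDiff.differentiable (by simp) q).hasFDerivAt

theorem contDiff_apply (h : IsAnalyticFlow φ V) (t : ℂ) : ContDiff ℂ ω (φ t) :=
  h.contDiff.comp (contDiff_const.prodMk contDiff_id)

theorem differentiable_apply (h : IsAnalyticFlow φ V) (t : ℂ) : Differentiable ℂ (φ t) :=
  (h.contDiff_apply t).differentiable (by simp)

theorem fderiv_apply_right (h : IsAnalyticFlow φ V) (t : ℂ) (x v : E) :
    fderiv ℂ (fun q : ℂ × E => φ q.1 q.2) (t, x) (0, v) = fderiv ℂ (φ t) x v := by
  have h1 : HasFDerivAt (fun y : E => (t, y)) (ContinuousLinearMap.inr ℂ ℂ E) x :=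
    hasFDerivAt_prodMk_right t x
  have h2 := (h.hasFDerivAt (t, x)).comp x h1
  have h3 : fderiv ℂ (φ t) x = _ := h2.fderiv
  rw [h3]
  rfl

theorem fderiv_zero (h : IsAnalyticFlow φ V) (x : E) (s : ℂ) (v : E) :
    fderiv ℂ (fun q : ℂ × E => φ q.1 q.2) (0, x) (s, v) = s • V x + v := by
  have h1 : HasDerivAt (fun t : ℂ => (t, x)) ((1 : ℂ), (0 : E)) 0 :=
    (hasDerivAt_id (0 : ℂ)).prodMk (hasDerivAt_const _ _)
  have h2 := (h.hasFDerivAt (0, x)).comp_hasDerivAt (0 : ℂ) h1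
  have h3 := h2.unique (h.hasDerivAt_zero x)
  have h4 : φ 0 = id := funext h.zero_apply
  have h5 : ((s, v) : ℂ × E) = s • ((1 : ℂ), (0 : E)) + ((0 : ℂ), v) := by simp
  rw [h5, map_add, map_smul, h3, h.fderiv_apply_right, h4, fderiv_id,
    ContinuousLinearMap.id_apply]

theorem contDiff_field (h : IsAnalyticFlow φ V) : ContDiff ℂ ω V := by
  have h1 : V = fun x => fderiv ℂ (fun q : ℂ × E => φ q.1 q.2) (0, x) ((1 : ℂ), (0 : E)) := by
    funext x
    rw [h.fderiv_zero]
    simp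
  rw [h1]
  have h2 : ContDiff ℂ ω (fderiv ℂ fun q : ℂ × E => φ q.1 q.2) := h.contDiff.fderiv_right le_rfl
  exact (h2.comp (contDiff_const.prodMk contDiff_id)).clm_apply contDiff_const

/-- At time zero, the derivative of the field `W` pulled back along `φ` is the Lie bracket of the
fields, here zero. It rests on the symmetry of the mixed second derivatives of `φ` in time and
position. -/
theorem hasDerivAt_pullback_zero (h : IsAnalyticFlow φ V) (hW : Differentiable ℂ W)
    (hVW : ∀ x, fderiv ℂ V x (W x) = fderiv ℂ W x (V x)) (y : E) :
    HasDerivAt (fun s => fderiv ℂ (φ (-s)) (φ s y) (W (φ s y))) 0 0 := by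
  set F : ℂ × E → E := fun q => φ q.1 q.2 with hF
  have hF2 : ContDiff ℂ ω (fderiv ℂ F) := h.contDiff.fderiv_right le_rfl
  have h1 : (fun s => fderiv ℂ (φ (-s)) (φ s y) (W (φ s y))) =
      fun s => fderiv ℂ F (-s, φ s y) (0, W (φ s y)) := by
    funext s
    rw [h.fderiv_apply_right]
  have hc : HasDerivAt (fun s : ℂ => (-s, φ s y)) ((-1 : ℂ), V y) 0 :=
    (hasDerivAt_neg (0 : ℂ)).prodMk (h.hasDerivAt_zero y)
  have hd : HasFDerivAt (fderiv ℂ F) (fderiv ℂ (fderiv ℂ F) (0, y)) (-(0 : ℂ), φ 0 y) := by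
    rw [neg_zero, h.zero_apply]
    exact (hF2.differentiable (by simp) _).hasFDerivAt
  have h2 := hd.comp_hasDerivAt (0 : ℂ) hc
  have hWd : HasFDerivAt W (fderiv ℂ W y) (φ 0 y) := by
    rw [h.zero_apply]
    exact (hW y).hasFDerivAt
  have h3 : HasDerivAt (fun s => ((0 : ℂ), W (φ s y))) ((0 : ℂ), fderiv ℂ W y (V y)) 0 :=
    (hasDerivAt_const _ _).prodMk (hWd.comp_hasDerivAt (0 : ℂ) (h.hasDerivAt_zero y))
  have h4 := h2.clm_apply h3
  rw [h1]
  refine h4.congr_deriv ?_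
  have hsymm : IsSymmSndFDerivAt ℂ F (0, y) :=
    h.contDiff.contDiffAt.isSymmSndFDerivAt_of_omega
  have h5 : HasFDerivAt (fun x : E => fderiv ℂ F (0, x) ((-1 : ℂ), V y))
      ((ContinuousLinearMap.apply ℂ E ((-1 : ℂ), V y)).comp
        ((fderiv ℂ (fderiv ℂ F) (0, y)).comp (ContinuousLinearMap.inr ℂ ℂ E))) y := by
    have h6 := ((hF2.differentiable (by simp) (0, y)).hasFDerivAt).comp y
      (hasFDerivAt_prodMk_right (𝕜 := ℂ) (0 : ℂ) y)
    exact (ContinuousLinearMap.apply ℂ E ((-1 : ℂ), V y)).hasFDerivAt.comp y h6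
  have h7 : (fun x : E => fderiv ℂ F (0, x) ((-1 : ℂ), V y)) = fun x => -V x + V y := by
    funext x
    rw [h.fderiv_zero]
    simp
  rw [h7] at h5
  have h8 := h5.unique (((h.contDiff_field.differentiable (by simp) y).hasFDerivAt.neg).add_const
    (V y))
  have h9 := DFunLike.congr_fun h8 (W y)
  simp only [ContinuousLinearMap.comp_apply, ContinuousLinearMap.inr_apply,
    ContinuousLinearMap.apply_apply, _root_.neg_apply] at h9
  simp only [Function.comp_apply, neg_zero, h.zero_apply]
  rw [hsymm.eq, h9, h.fderiv_zero, hVW]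
  simp

/-- A flow preserves every vector field that commutes with its own. -/
theorem fderiv_apply_field (h : IsAnalyticFlow φ V) (hW : Differentiable ℂ W)
    (hVW : ∀ x, fderiv ℂ V x (W x) = fderiv ℂ W x (V x)) (t : ℂ) (x : E) :
    fderiv ℂ (φ t) x (W x) = W (φ t x) := by
  have key : ∀ x t, fderiv ℂ (φ (-t)) (φ t x) (W (φ t x)) = W x := by
    intro x t
    have hder : ∀ t, HasDerivAt (fun t => fderiv ℂ (φ (-t)) (φ t x) (W (φ t x))) 0 t := by
      intro t
      -- By the group law, the derivative at time `t` is that at time `0` from the point `φ t x`.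
      have h1 : (fun s => fderiv ℂ (φ (-s)) (φ s x) (W (φ s x))) = fun s =>
          fderiv ℂ (φ (-t)) (φ t x) (fderiv ℂ (φ (-(s - t))) (φ (s - t) (φ t x))
            (W (φ (s - t) (φ t x)))) := by
        funext s
        have h2 : φ (-s) = φ (-t) ∘ φ (-(s - t)) := by
          funext z
          rw [Function.comp_apply, ← h.add_apply]
          ring_nf
        rw [← h.add_apply (s - t) t x, sub_add_cancel, h2,
          fderiv_comp _ (h.differentiable_apply _ _) (h.differentiable_apply _ _),
          ContinuousLinearMap.comp_apply, ← h.add_apply]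
        ring_nf
      rw [h1]
      have h3 := h.hasDerivAt_pullback_zero hW hVW (φ t x)
      rw [← sub_self t] at h3
      have h4 := HasDerivAt.comp_sub_const t t h3
      have h5 := (fderiv ℂ (φ (-t)) (φ t x)).hasFDerivAt.comp_hasDerivAt t h4
      rw [map_zero] at h5
      exact h5
    have h6 := is_const_of_deriv_eq_zero (fun t => (hder t).differentiableAt)
      (fun t => (hder t).deriv) t 0
    rw [h6, neg_zero, h.zero_apply, funext h.zero_apply, fderiv_fun_id]
    rfl
  have h7 := key (φ t x) (-t)
  rwa [neg_neg, h.neg_apply_apply] at h7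

/-- The flows of commuting vector fields commute. -/
theorem commute (h : IsAnalyticFlow φ V) (h' : IsAnalyticFlow ψ W)
    (hVW : ∀ x, fderiv ℂ V x (W x) = fderiv ℂ W x (V x)) (s t : ℂ) (x : E) :
    φ s (ψ t x) = ψ t (φ s x) := by
  -- It suffices that `ψ (-t) (φ s (ψ t x))` does not depend on `t`.
  have hder : ∀ t, HasDerivAt (fun t => ψ (-t) (φ s (ψ t x))) 0 t := by
    intro t
    have h1 : (fun u => ψ (-u) (φ s (ψ u x))) =
        fun u => ψ (-t) (ψ (-(u - t)) (φ s (ψ (u - t) (ψ t x)))) := by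
      funext u
      rw [← h'.add_apply, ← h'.add_apply]
      ring_nf
    have h2 : HasDerivAt (fun u => ψ (-u) (φ s (ψ u (ψ t x)))) 0 0 := by
      set y := ψ t x
      have h3 : HasDerivAt (fun u => φ s (ψ u y)) (W (φ s y)) 0 := by
        rw [← h.fderiv_apply_field (h'.contDiff_field.differentiable (by simp)) hVW]
        have h4 : HasFDerivAt (φ s) (fderiv ℂ (φ s) y) (ψ 0 y) := by
          rw [h'.zero_apply]
          exact (h.differentiable_apply s y).hasFDerivAt
        exact h4.comp_hasDerivAt (0 : ℂ) (h'.hasDerivAt_zero y)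
      have h5 : HasFDerivAt (fun q : ℂ × E => ψ q.1 q.2)
          (fderiv ℂ (fun q : ℂ × E => ψ q.1 q.2) (0, φ s y)) (-(0 : ℂ), φ s (ψ 0 y)) := by
        rw [neg_zero, h'.zero_apply]
        exact h'.hasFDerivAt _
      have h6 := h5.comp_hasDerivAt (0 : ℂ) ((hasDerivAt_neg (0 : ℂ)).prodMk h3)
      rw [h'.fderiv_zero, neg_one_smul, neg_add_cancel] at h6
      exact h6
    rw [h1]
    rw [← sub_self t] at h2
    have h7 := HasDerivAt.comp_sub_const t t h2
    have h8 : HasFDerivAt (ψ (-t)) (fderiv ℂ (ψ (-t)) (ψ (-(t - t)) (φ s (ψ (t - t) (ψ t x)))))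
        (ψ (-(t - t)) (φ s (ψ (t - t) (ψ t x)))) :=
      (h'.differentiable_apply (-t) _).hasFDerivAt
    have h9 := h8.comp_hasDerivAt t h7
    rw [map_zero] at h9
    exact h9
  have h10 := is_const_of_deriv_eq_zero (fun t => (hder t).differentiableAt)
    (fun t => (hder t).deriv) t 0
  rw [neg_zero, h'.zero_apply, h'.zero_apply] at h10
  rw [← h10, h'.apply_neg_apply]

/-- A function whose derivative along the vector field vanishes is invariant under the flow. -/
theorem invariant (h : IsAnalyticFlow φ V) {f : E → ℂ} (hf : Differentiable ℂ f)
    (hfV : ∀ x, fderiv ℂ f x (V x) = 0) (t : ℂ) (x : E) : f (φ t x) = f x := by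
  have hder : ∀ t, HasDerivAt (fun t => f (φ t x)) 0 t := by
    intro t
    rw [← hfV (φ t x)]
    exact (hf (φ t x)).hasFDerivAt.comp_hasDerivAt t (h.hasDerivAt t x)
  have h1 := is_const_of_deriv_eq_zero (fun t => (hder t).differentiableAt)
    (fun t => (hder t).deriv) t 0
  rwa [h.zero_apply] at h1

end IsAnalyticFlow

section Compose

variable {ι : Type*} {φ : ι → ℂ → E → E} {V : ι → E → E}

theorem composeFlows_zero (h : ∀ k, IsAnalyticFlow (φ k) (V k)) (l : List ι) (x : E) :
    composeFlows φ l 0 x = x := by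
  induction l with
  | nil => rfl
  | cons k l ih =>
    change φ k 0 (composeFlows φ l 0 x) = x
    rw [ih, (h k).zero_apply]

theorem composeFlows_add (h : ∀ k, IsAnalyticFlow (φ k) (V k))
    (hc : ∀ k l s t x, φ k s (φ l t x) = φ l t (φ k s x)) (l : List ι) (v w : ι → ℂ) (x : E) :
    composeFlows φ l (v + w) x = composeFlows φ l v (composeFlows φ l w x) := by
  induction l with
  | nil => rfl
  | cons k l ih =>
    change φ k (v k + w k) (composeFlows φ l (v + w) x) =
      φ k (v k) (composeFlows φ l v (φ k (w k) (composeFlows φ l w x)))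
    rw [ih, (h k).add_apply, ← apply_composeFlows hc k (w k)]

theorem contDiff_composeFlows [Fintype ι] (h : ∀ k, IsAnalyticFlow (φ k) (V k)) (l : List ι) :
    ContDiff ℂ ω fun q : (ι → ℂ) × E => composeFlows φ l q.1 q.2 := by
  induction l with
  | nil => exact contDiff_snd
  | cons k l ih =>
    exact (h k).contDiff.comp (((contDiff_apply ℂ ℂ k).comp contDiff_fst).prodMk ih)

theorem hasDerivAt_composeFlows (h : ∀ k, IsAnalyticFlow (φ k) (V k)) (l : List ι) (v : ι → ℂ)
    (x : E) : HasDerivAt (fun t : ℂ => composeFlows φ l (t • v) x)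
      (l.map fun k => v k • V k x).sum 0 := by
  induction l with
  | nil => exact hasDerivAt_const _ _
  | cons k l ih =>
    have h1 : HasDerivAt (fun t : ℂ => (t * v k, composeFlows φ l (t • v) x))
        (v k, (l.map fun k => v k • V k x).sum) 0 := by
      refine HasDerivAt.prodMk ?_ ih
      simpa using (hasDerivAt_id (0 : ℂ)).mul_const (v k)
    have h2 : HasFDerivAt (fun q : ℂ × E => φ k q.1 q.2)
        (fderiv ℂ (fun q : ℂ × E => φ k q.1 q.2) (0, x))
        (0 * v k, composeFlows φ l ((0 : ℂ) • v) x) := by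
      rw [zero_mul, zero_smul, composeFlows_zero h]
      exact (h k).hasFDerivAt _
    have h3 := h2.comp_hasDerivAt (0 : ℂ) h1
    rw [(h k).fderiv_zero] at h3
    rw [List.map_cons, List.sum_cons]
    exact h3

end Compose

end Flows

theorem isAnalyticFlow_minorFlow {n p : ℕ} {r c : Fin p → Fin n} (hr : r.Injective)
    (hc : c.Injective) :
    IsAnalyticFlow (minorFlow r c) (hamiltonianField fun Y => (Y.submatrix r c).det) where
  zero_apply := minorFlow_zero
  add_apply := minorFlow_add
  contDiff := contDiff_minorFlow
  hasDerivAt_zero := hasDerivAt_minorFlow_zero hr hc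

/-! ### Functions in involution have commuting Hamiltonian vector fields -/

/-- The quadratic expression `(s_{ik} + s_{jl}) x_{il} x_{kj}` of the Poisson bivector, polarized in
`X` and contracted with the covector `L`. The Hamiltonian vector field of `h` at `X` is
`bivectorMap X X L`, with `L` the matrix of partial derivatives of `h`. -/
noncomputable def bivectorMap (X Y L : Matrix (Fin n) (Fin n) ℂ) : Matrix (Fin n) (Fin n) ℂ :=
  Matrix.of fun i j => ∑ k, ∑ l, (sgn i k + sgn j l) * X i l * Y k j * L k l

/-- The matrix of partial derivatives of `h` at `X`. -/
noncomputable def partialMatrix (h : Matrix (Fin n) (Fin n) ℂ → ℂ) (X : Matrix (Fin n) (Fin n) ℂ) :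
    Matrix (Fin n) (Fin n) ℂ :=
  Matrix.of fun k l => partialDeriv h k l X

theorem hamiltonianField_eq_bivectorMap (h : Matrix (Fin n) (Fin n) ℂ → ℂ)
    (X : Matrix (Fin n) (Fin n) ℂ) :
    hamiltonianField h X = bivectorMap X X (partialMatrix h X) := by
  ext i j
  simp [hamiltonianField_apply, bivectorMap, partialMatrix]

theorem fderiv_eq_sum_partialMatrix (h : Matrix (Fin n) (Fin n) ℂ → ℂ)
    (X A : Matrix (Fin n) (Fin n) ℂ) :
    fderiv ℂ h X A = ∑ k, ∑ l, partialMatrix h X k l * A k l := by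
  rw [clm_apply_eq_sum]
  simp only [partialMatrix, partialDeriv, Matrix.of_apply, mul_comm]

theorem sum_comm_pairs (f : Fin n → Fin n → Fin n → Fin n → ℂ) :
    ∑ k, ∑ l, ∑ p, ∑ q, f k l p q = ∑ p, ∑ q, ∑ k, ∑ l, f k l p q := by
  calc ∑ k, ∑ l, ∑ p, ∑ q, f k l p q = ∑ k, ∑ p, ∑ l, ∑ q, f k l p q :=
        Finset.sum_congr rfl fun k _ => Finset.sum_comm
    _ = ∑ p, ∑ k, ∑ l, ∑ q, f k l p q := Finset.sum_comm
    _ = ∑ p, ∑ k, ∑ q, ∑ l, f k l p q :=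
        Finset.sum_congr rfl fun p _ => Finset.sum_congr rfl fun k _ => Finset.sum_comm
    _ = ∑ p, ∑ q, ∑ k, ∑ l, f k l p q := Finset.sum_congr rfl fun p _ => Finset.sum_comm

theorem sum_mul_bivectorMap_antisymm (X L M : Matrix (Fin n) (Fin n) ℂ) :
    ∑ i, ∑ j, L i j * bivectorMap X X M i j = -∑ i, ∑ j, M i j * bivectorMap X X L i j := by
  simp only [bivectorMap, Matrix.of_apply, Finset.mul_sum, ← Finset.sum_neg_distrib]
  rw [sum_comm_pairs]
  refine Finset.sum_congr rfl fun k _ => Finset.sum_congr rfl fun l _ =>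
    Finset.sum_congr rfl fun i _ => Finset.sum_congr rfl fun j _ => ?_
  rw [sgn_swap k i, sgn_swap l j]
  ring

/-- The modified classical Yang-Baxter identity for the signs. The left side is `0` if all three
indices coincide. -/
theorem sgn_cyclic (i k p : Fin n) (h : ¬(i = k ∧ k = p)) :
    sgn i k * sgn k p - sgn i p * sgn i k - sgn k p * sgn i p = -1 := by
  rcases lt_trichotomy i k with h1 | h1 | h1 <;> rcases lt_trichotomy k p with h2 | h2 | h2 <;>
    rcases lt_trichotomy i p with h3 | h3 | h3 <;>
    first
    | (exfalso; omega)
    | skip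
  all_goals
    first
    | rw [sgn_of_lt h1]
    | rw [(by rw [h1, sgn_self] : sgn i k = 0)]
    | rw [sgn_swap k i, sgn_of_lt h1]
    first
    | rw [sgn_of_lt h2]
    | rw [(by rw [h2, sgn_self] : sgn k p = 0)]
    | rw [sgn_swap p k, sgn_of_lt h2]
    first
    | rw [sgn_of_lt h3]
    | rw [(by rw [h3, sgn_self] : sgn i p = 0)]
    | rw [sgn_swap p i, sgn_of_lt h3]
  all_goals norm_num

/-- The constants of the row and the column identity differ only if all row indices or all column
indices coincide, and then the two cubic monomials are equal. -/
theorem sgn_cyclic_mul (X : Matrix (Fin n) (Fin n) ℂ) (i k p j l q : Fin n) :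
    ((sgn i k * sgn k p - sgn i p * sgn i k - sgn k p * sgn i p) -
      (sgn j l * sgn l q - sgn j q * sgn j l - sgn l q * sgn j q)) *
      (X i l * X k q * X p j - X k j * X i q * X p l) = 0 := by
  by_cases h1 : i = k ∧ k = p
  · obtain ⟨rfl, rfl⟩ := h1
    ring
  · by_cases h2 : j = l ∧ l = q
    · obtain ⟨rfl, rfl⟩ := h2
      ring
    · rw [sgn_cyclic i k p h1, sgn_cyclic j l q h2]
      ring

/-- The Jacobi identity of the bracket, contracted with two covectors `L` and `M`. -/
theorem bivectorMap_jacobi (X L M : Matrix (Fin n) (Fin n) ℂ) (i j : Fin n) :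
    (bivectorMap (bivectorMap X X M) X L i j + bivectorMap X (bivectorMap X X M) L i j) -
      (bivectorMap (bivectorMap X X L) X M i j + bivectorMap X (bivectorMap X X L) M i j) -
      ∑ k, ∑ l, L k l *
        (bivectorMap (Matrix.of fun k l => (sgn i k + sgn j l) * X i l * X k j) X M +
        bivectorMap X (Matrix.of fun k l => (sgn i k + sgn j l) * X i l * X k j) M) k l = 0 := by
  have h1 : bivectorMap (bivectorMap X X M) X L i j + bivectorMap X (bivectorMap X X M) L i j =
      ∑ k, ∑ l, ∑ p, ∑ q, L k l * M p q * ((sgn i k + sgn j l) *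
        ((sgn i p + sgn l q) * X i q * X p l * X k j +
          X i l * ((sgn k p + sgn j q) * X k q * X p j))) := by
    simp only [bivectorMap, Matrix.of_apply, ← Finset.sum_add_distrib, Finset.mul_sum,
      Finset.sum_mul]
    refine Finset.sum_congr rfl fun k _ => Finset.sum_congr rfl fun l _ =>
      Finset.sum_congr rfl fun p _ => Finset.sum_congr rfl fun q _ => ?_
    ring
  have h2 : bivectorMap (bivectorMap X X L) X M i j + bivectorMap X (bivectorMap X X L) M i j =
      ∑ k, ∑ l, ∑ p, ∑ q, L k l * M p q * ((sgn i p + sgn j q) *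
        ((sgn i k + sgn q l) * X i l * X k q * X p j +
          X i q * ((sgn p k + sgn j l) * X p l * X k j))) := by
    rw [sum_comm_pairs]
    simp only [bivectorMap, Matrix.of_apply, ← Finset.sum_add_distrib, Finset.mul_sum,
      Finset.sum_mul]
    refine Finset.sum_congr rfl fun p _ => Finset.sum_congr rfl fun q _ =>
      Finset.sum_congr rfl fun k _ => Finset.sum_congr rfl fun l _ => ?_
    ring
  rw [h1, h2]
  simp only [bivectorMap, Matrix.of_apply, Matrix.add_apply, ← Finset.sum_add_distrib,
    Finset.mul_sum, ← Finset.sum_sub_distrib]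
  refine Finset.sum_eq_zero fun k _ => Finset.sum_eq_zero fun l _ =>
    Finset.sum_eq_zero fun p _ => Finset.sum_eq_zero fun q _ => ?_
  rw [sgn_swap k p, sgn_swap l q]
  linear_combination L k l * M p q * sgn_cyclic_mul X i k p j l q

section Hessian

variable {E : Type*} [NormedAddCommGroup E] [NormedSpace ℂ E] {h : E → ℂ}

/-- The second derivative of `h` at `x`, in the directions `w` and `a`. -/
noncomputable def hessian (h : E → ℂ) (x w a : E) : ℂ := fderiv ℂ (fderiv ℂ h) x w a

theorem hessian_symm (hh : ContDiff ℂ ω h) (x w a : E) : hessian h x w a = hessian h x a w := by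
  have hs : IsSymmSndFDerivAt ℂ h x := hh.contDiffAt.isSymmSndFDerivAt_of_omega
  exact hs.eq w a

theorem hessian_add_right (h : E → ℂ) (x w a b : E) :
    hessian h x w (a + b) = hessian h x w a + hessian h x w b :=
  map_add _ _ _

theorem hessian_smul_right (h : E → ℂ) (x w : E) (c : ℂ) (a : E) :
    hessian h x w (c • a) = c * hessian h x w a :=
  map_smul _ _ _

theorem contDiff_fderiv_apply (hh : ContDiff ℂ ω h) (v : E) :
    ContDiff ℂ ω fun x => fderiv ℂ h x v := by
  have hh2 : ContDiff ℂ ω (fderiv ℂ h) := hh.fderiv_right le_rfl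
  exact hh2.clm_apply contDiff_const

theorem hasDerivAt_line {F : Type*} [NormedAddCommGroup F] [NormedSpace ℂ F]
    {f : E → F} {x : E} (hf : DifferentiableAt ℂ f x) (w : E) :
    HasDerivAt (fun t : ℂ => f (x + t • w)) (fderiv ℂ f x w) 0 :=
  hf.hasFDerivAt.hasLineDerivAt w

theorem hasDerivAt_fderiv_line (hh : ContDiff ℂ ω h) (x w : E) {b : ℂ → E} {b' : E}
    (hb : HasDerivAt b b' 0) :
    HasDerivAt (fun t : ℂ => fderiv ℂ h (x + t • w) (b t))
      (hessian h x w (b 0) + fderiv ℂ h x b') 0 := by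
  have hh2 : ContDiff ℂ ω (fderiv ℂ h) := hh.fderiv_right le_rfl
  have h1 := (hasDerivAt_line (hh2.differentiable (by simp) x) w).clm_apply hb
  simp only [zero_smul, add_zero] at h1
  exact h1

end Hessian

/-- The second derivatives of `h` at `X`, contracted once with `W`. -/
noncomputable def hessianMatrix (h : Matrix (Fin n) (Fin n) ℂ → ℂ)
    (X W : Matrix (Fin n) (Fin n) ℂ) : Matrix (Fin n) (Fin n) ℂ :=
  Matrix.of fun k l => hessian h X W (Matrix.single k l 1)

theorem sum_hessianMatrix_mul (h : Matrix (Fin n) (Fin n) ℂ → ℂ)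
    (X W A : Matrix (Fin n) (Fin n) ℂ) :
    ∑ k, ∑ l, hessianMatrix h X W k l * A k l = hessian h X W A := by
  have h1 := clm_apply_eq_sum (LinearMap.toContinuousLinearMap
    { toFun := hessian h X W
      map_add' := hessian_add_right h X W
      map_smul' := hessian_smul_right h X W }) A
  refine Eq.trans ?_ h1.symm
  simp only [hessianMatrix, Matrix.of_apply, mul_comm]
  rfl

section Fields

variable {h g : Matrix (Fin n) (Fin n) ℂ → ℂ}

theorem differentiable_hamiltonianField (hh : ContDiff ℂ ω h) :
    Differentiable ℂ (hamiltonianField h) := by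
  have : ContDiff ℂ ω (hamiltonianField h) := by
    refine contDiff_pi' fun i => contDiff_pi' fun j => ?_
    simp only [hamiltonianField_apply]
    refine ContDiff.sum fun k _ => ContDiff.sum fun l _ => ?_
    exact ((contDiff_const.mul (contDiff_entry i l)).mul (contDiff_entry k j)).mul
      (contDiff_fderiv_apply hh _)
  exact this.differentiable (by simp)

theorem fderiv_hamiltonianField (hh : ContDiff ℂ ω h) (X W : Matrix (Fin n) (Fin n) ℂ) :
    fderiv ℂ (hamiltonianField h) X W =
      bivectorMap W X (partialMatrix h X) + bivectorMap X W (partialMatrix h X) +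
        bivectorMap X X (hessianMatrix h X W) := by
  have h1 := hasDerivAt_line (differentiable_hamiltonianField hh X) W
  refine h1.unique ?_
  refine hasDerivAt_pi.2 fun i => hasDerivAt_pi.2 fun j => ?_
  have hX : ∀ i j, HasDerivAt (fun t : ℂ => (X + t • W) i j) (W i j) 0 := by
    intro i j
    simpa using ((hasDerivAt_id (0 : ℂ)).mul_const (W i j)).const_add (X i j)
  have hd : ∀ k l, HasDerivAt (fun t : ℂ => partialDeriv h k l (X + t • W))
      (hessianMatrix h X W k l) 0 := by
    intro k l
    have h2 := hasDerivAt_fderiv_line hh X W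
      (hasDerivAt_const (0 : ℂ) (Matrix.single k l (1 : ℂ)))
    refine HasDerivAt.congr_deriv h2 ?_
    rw [map_zero, add_zero]
    rfl
  have h4 : HasDerivAt (fun t : ℂ => ∑ k, ∑ l, (sgn i k + sgn j l) * (X + t • W) i l *
      (X + t • W) k j * partialDeriv h k l (X + t • W)) _ 0 :=
    HasDerivAt.fun_sum fun k _ => HasDerivAt.fun_sum fun l _ =>
      (((hX i l).const_mul (sgn i k + sgn j l)).mul (hX k j)).mul (hd k l)
  simp only [hamiltonianField_apply]
  refine h4.congr_deriv ?_
  simp only [bivectorMap, partialMatrix, Matrix.add_apply, Matrix.of_apply,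
    ← Finset.sum_add_distrib]
  refine Finset.sum_congr rfl fun k _ => Finset.sum_congr rfl fun l _ => ?_
  simp
  ring

/-- If `{h, g} = 0` identically, the Hamiltonian vector fields of `h` and `g` commute. -/
theorem commute_hamiltonianField (hh : ContDiff ℂ ω h) (hg : ContDiff ℂ ω g)
    (hhg : ∀ X, poissonBracket h g X = 0) (X : Matrix (Fin n) (Fin n) ℂ) :
    fderiv ℂ (hamiltonianField h) X (hamiltonianField g X) =
      fderiv ℂ (hamiltonianField g) X (hamiltonianField h X) := by
  -- Differentiate the identity `{h, g} = 0` in the direction `U`.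
  have hU : ∀ U : Matrix (Fin n) (Fin n) ℂ,
      hessian h X U (hamiltonianField g X) - hessian g X U (hamiltonianField h X) +
        ∑ k, ∑ l, partialMatrix h X k l * (bivectorMap U X (partialMatrix g X) +
          bivectorMap X U (partialMatrix g X)) k l = 0 := by
    intro U
    have h1 := hasDerivAt_fderiv_line hh X U
      (hasDerivAt_line (differentiable_hamiltonianField hg X) U)
    have h2 := h1.congr_of_eventuallyEq (f₁ := fun _ => 0) (Filter.Eventually.of_forall fun t =>
      (hhg _).symm.trans (poissonBracket_eq_fderiv h g (X + t • U)))
    have h3 : hessian h X U (hamiltonianField g X) +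
        fderiv ℂ h X (fderiv ℂ (hamiltonianField g) X U) = 0 := by
      have h4 := h2.unique (hasDerivAt_const (0 : ℂ) (0 : ℂ))
      simp only [zero_smul, add_zero] at h4
      exact h4
    rw [fderiv_hamiltonianField hg, map_add, fderiv_eq_sum_partialMatrix h X,
      fderiv_eq_sum_partialMatrix h X, sum_mul_bivectorMap_antisymm,
      ← hamiltonianField_eq_bivectorMap, sum_hessianMatrix_mul] at h3
    linear_combination h3
  ext i j
  -- The `(i, j)` entry pairs a covector with a fixed direction; `hU` is used in that direction, and
  -- the Jacobi identity accounts for the terms without second derivatives.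
  have h1 : ∀ L : Matrix (Fin n) (Fin n) ℂ, bivectorMap X X L i j = ∑ k, ∑ l, L k l *
      (Matrix.of fun k l => (sgn i k + sgn j l) * X i l * X k j :
        Matrix (Fin n) (Fin n) ℂ) k l := by
    intro L
    simp only [bivectorMap, Matrix.of_apply, mul_comm]
  rw [fderiv_hamiltonianField hh, fderiv_hamiltonianField hg]
  simp only [Matrix.add_apply]
  rw [h1 (hessianMatrix h _ _), h1 (hessianMatrix g _ _), sum_hessianMatrix_mul,
    sum_hessianMatrix_mul, hessian_symm hh X, hessian_symm hg X]
  have h2 := hU (Matrix.of fun k l => (sgn i k + sgn j l) * X i l * X k j)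
  have h3 := bivectorMap_jacobi X (partialMatrix h X) (partialMatrix g X) i j
  rw [← hamiltonianField_eq_bivectorMap, ← hamiltonianField_eq_bivectorMap] at h3
  simp only [Matrix.add_apply] at h2 h3 ⊢
  linear_combination h2 + h3

end Fields

/-! ### Minors in involution -/

/-- Where `B` and `B'` are both nonzero off the diagonal, the sign is `1`; the diagonal contributes
`δ δ'` for every common index. -/
theorem sum_sgn_mul_eq_of_isRowScalar {I I' : Finset (Fin n)} {δ δ' : ℂ}
    {B B' : Matrix (Fin n) (Fin n) ℂ} (h : IsRowScalar (I : Set (Fin n)) δ B)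
    (h' : IsRowScalar (I' : Set (Fin n)) δ' B')
    (hlt : ∀ i ∈ I', i ∉ I → ∀ k ∈ I, k ∉ I' → i < k) :
    ∑ i, ∑ k, sgn i k * (B i k * B' k i) =
      (B * B').trace - ((I ∩ I').card : ℂ) * (δ * δ') := by
  have key : ∀ i k, sgn i k * (B i k * B' k i) =
      B i k * B' k i - if i = k then (if i ∈ I ∩ I' then δ * δ' else 0) else 0 := by
    intro i k
    by_cases hik : i = k
    · subst hik
      rw [sgn_self, if_pos rfl, zero_mul, eq_comm, sub_eq_zero]
      by_cases hi : i ∈ I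
      · by_cases hi' : i ∈ I'
        · simp [h.row_eq i i hi, h'.row_eq i i hi', hi, hi']
        · simp [h'.col_eq_zero i i hi', hi']
      · simp [h.col_eq_zero i i hi, hi]
    · rw [if_neg hik, sub_zero]
      by_cases hz : B i k * B' k i = 0
      · rw [hz, mul_zero]
      · have hB : B i k ≠ 0 := left_ne_zero_of_mul hz
        have hB' : B' k i ≠ 0 := right_ne_zero_of_mul hz
        have hk : k ∈ I := by
          by_contra hk
          exact hB (h.col_eq_zero i k hk)
        have hi' : i ∈ I' := by
          by_contra hi'
          exact hB' (h'.col_eq_zero k i hi')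
        have hi : i ∉ I := fun hi => hB (by rw [h.row_eq i k hi, if_neg hik])
        have hk' : k ∉ I' := fun hk' => hB' (by rw [h'.row_eq k i hk', if_neg (Ne.symm hik)])
        rw [sgn_of_lt (hlt i hi' hi k hk hk'), one_mul]
  simp only [key, Finset.sum_sub_distrib]
  congr 1
  simp only [Finset.sum_ite_eq, Finset.mem_univ, if_true]
  rw [Finset.sum_ite_mem, Finset.univ_inter, Finset.sum_const, nsmul_eq_mul]

theorem poissonBracket_eq_sum (f h : Matrix (Fin n) (Fin n) ℂ → ℂ)
    (X F G : Matrix (Fin n) (Fin n) ℂ) (hF : ∀ k l, partialDeriv f k l X = F l k)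
    (hG : ∀ k l, partialDeriv h k l X = G l k) :
    poissonBracket f h X = ∑ i, ∑ k, sgn i k * ((X * G) i k * (X * F) k i) -
      ∑ l, ∑ j, sgn l j * ((G * X) l j * (F * X) j l) := by
  rw [poissonBracket_eq_fderiv, clm_apply_eq_sum, hamiltonianField_eq h X G hG]
  have h1 : ∀ A : Matrix (Fin n) (Fin n) ℂ,
      ∑ i, ∑ j, A i j * fderiv ℂ f X (Matrix.single i j 1) = (A * F).trace := by
    intro A
    simp only [Matrix.trace, Matrix.diag_apply, Matrix.mul_apply]
    refine Finset.sum_congr rfl fun i _ => Finset.sum_congr rfl fun j _ => ?_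
    rw [← hF, partialDeriv]
  rw [h1, Matrix.add_mul, Matrix.trace_add, Matrix.mul_assoc, Matrix.mul_assoc,
    Matrix.trace_mul_comm X, Matrix.mul_assoc, sub_eq_add_neg]
  congr 1
  · simp only [Matrix.trace, Matrix.diag_apply]
    refine Finset.sum_congr rfl fun i _ => ?_
    rw [Matrix.mul_apply]
    refine Finset.sum_congr rfl fun k _ => ?_
    rw [hadamard_apply, Matrix.of_apply, mul_assoc]
  · simp only [Matrix.trace, Matrix.diag_apply, ← Finset.sum_neg_distrib]
    refine Finset.sum_congr rfl fun l _ => ?_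
    rw [Matrix.mul_apply]
    refine Finset.sum_congr rfl fun j _ => ?_
    rw [hadamard_apply, Matrix.of_apply, sgn_swap l j]
    ring

/-- Two minors Poisson commute if their row sets and their column sets are separated, in opposite
orders, and have equally many common elements. -/
theorem poissonBracket_minor_eq_zero {I I' J J' : Finset (Fin n)} (h : I.card = J.card)
    (h' : I'.card = J'.card) (hcard : (I ∩ I').card = (J ∩ J').card)
    (hI : ∀ i ∈ I', i ∉ I → ∀ k ∈ I, k ∉ I' → i < k)
    (hJ : ∀ l ∈ J, l ∉ J' → ∀ j ∈ J', j ∉ J → l < j) (X : Matrix (Fin n) (Fin n) ℂ) :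
    poissonBracket (minor I' J' h') (minor I J h) X = 0 := by
  set r := I.orderEmbOfFin rfl
  set c := J.orderEmbOfFin h.symm
  set r' := I'.orderEmbOfFin rfl
  set c' := J'.orderEmbOfFin h'.symm
  have hr := isRowScalar_mul_minorGrad r c X
  have hr' := isRowScalar_mul_minorGrad r' c' X
  have hc := isRowScalar_minorGrad_mul r c X
  have hc' := isRowScalar_minorGrad_mul r' c' X
  rw [Finset.range_orderEmbOfFin] at hr hr' hc hc'
  rw [poissonBracket_eq_sum (minor I' J' h') (minor I J h) X (minorGrad r' c' X) (minorGrad r c X)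
    (partialDeriv_minor r'.injective c'.injective X) (partialDeriv_minor r.injective c.injective X),
    sum_sgn_mul_eq_of_isRowScalar hr hr' hI]
  have h1 : ∑ l, ∑ j, sgn l j * ((minorGrad r c X * X) l j * (minorGrad r' c' X * X) j l) =
      ∑ l, ∑ j, sgn l j * ((minorGrad r' c' X * X)ᵀ l j * (minorGrad r c X * X)ᵀ j l) := by
    simp only [Matrix.transpose_apply, mul_comm]
  rw [h1, sum_sgn_mul_eq_of_isRowScalar hc' hc hJ, ← Matrix.transpose_mul, Matrix.trace_transpose,
    Finset.inter_comm J' J, hcard]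
  have h2 : (X * minorGrad r c X * (X * minorGrad r' c' X)).trace =
      (minorGrad r c X * X * (minorGrad r' c' X * X)).trace := by
    rw [Matrix.mul_assoc, Matrix.trace_mul_comm X]
    simp only [Matrix.mul_assoc]
  rw [h2]
  ring

theorem poissonBracket_antisymm (f g : Matrix (Fin n) (Fin n) ℂ → ℂ)
    (X : Matrix (Fin n) (Fin n) ℂ) : poissonBracket f g X = -poissonBracket g f X := by
  rw [poissonBracket_eq_fderiv, poissonBracket_eq_fderiv, fderiv_eq_sum_partialMatrix f,
    fderiv_eq_sum_partialMatrix g, hamiltonianField_eq_bivectorMap, hamiltonianField_eq_bivectorMap,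
    sum_mul_bivectorMap_antisymm]

/-! ### Inversions along a reduced word -/

/-- The pairs `a < b` of letters that occur in the opposite order in the one-line notation of
`w`. -/
def inversions (w : Equiv.Perm (Fin n)) : Finset (Fin n × Fin n) :=
  Finset.univ.filter fun x => x.1 < x.2 ∧ w⁻¹ x.2 < w⁻¹ x.1

theorem prefixProd_zero {N : ℕ} (j : Fin N → Fin (n - 1)) : prefixProd j 0 = 1 := by
  simp [prefixProd]

theorem prefixProd_succ {N : ℕ} (j : Fin N → Fin (n - 1)) (m : ℕ) (hm : m < N) :
    prefixProd j (m + 1) = prefixProd j m * simpleReflection (j ⟨m, hm⟩) := by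
  rw [prefixProd, prefixProd, List.take_add_one, List.prod_append]
  simp [hm]

/-- A simple reflection preserves the order of every pair but the one it exchanges. -/
theorem simpleReflection_lt_simpleReflection (i : Fin (n - 1)) {a b : Fin n} (hab : a < b)
    (h : ¬((a : ℕ) = i ∧ (b : ℕ) = i + 1)) : simpleReflection i a < simpleReflection i b := by
  unfold simpleReflection
  rw [Equiv.swap_apply_def, Equiv.swap_apply_def]
  simp only [Fin.ext_iff, Fin.lt_def] at *
  split_ifs <;> (try dsimp only) <;> omega

/-- One letter of a word changes the set of inversions by a single pair. -/
theorem inversions_mul_simpleReflection (w : Equiv.Perm (Fin n)) (i : Fin (n - 1)) :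
    ∃ x, inversions (w * simpleReflection i) ⊆ insert x (inversions w) ∧
      inversions w ⊆ insert x (inversions (w * simpleReflection i)) := by
  have hinv : ∀ a, (w * simpleReflection i)⁻¹ a = simpleReflection i (w⁻¹ a) := by
    intro a
    simp [simpleReflection, Equiv.swap_inv]
  have hinj := (simpleReflection (n := n) i).injective
  have hinv' : ∀ a, simpleReflection i (simpleReflection i a) = a := by
    intro a
    simp [simpleReflection]
  set a := w ⟨i, by omega⟩ with ha
  set b := w ⟨i + 1, by omega⟩ with hb
  have key : ∀ y : Fin n × Fin n, y.1 < y.2 → y ≠ (min a b, max a b) →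
      (y ∈ inversions (w * simpleReflection i) ↔ y ∈ inversions w) := by
    rintro ⟨c, d⟩ hcd hne
    have hn1 : ¬((w⁻¹ c : ℕ) = i ∧ (w⁻¹ d : ℕ) = i + 1) := by
      rintro ⟨h1, h2⟩
      have h3 : c = a := by rw [ha, ← Equiv.Perm.inv_eq_iff_eq]; exact Fin.ext h1
      have h4 : d = b := by rw [hb, ← Equiv.Perm.inv_eq_iff_eq]; exact Fin.ext h2
      subst h3 h4
      exact hne (by rw [min_eq_left hcd.le, max_eq_right hcd.le])
    have hn2 : ¬((w⁻¹ d : ℕ) = i ∧ (w⁻¹ c : ℕ) = i + 1) := by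
      rintro ⟨h1, h2⟩
      have h3 : d = a := by rw [ha, ← Equiv.Perm.inv_eq_iff_eq]; exact Fin.ext h1
      have h4 : c = b := by rw [hb, ← Equiv.Perm.inv_eq_iff_eq]; exact Fin.ext h2
      subst h3 h4
      exact hne (by rw [min_eq_right hcd.le, max_eq_left hcd.le])
    simp only [inversions, Finset.mem_filter, Finset.mem_univ, true_and, hinv]
    refine and_congr_right fun _ => ⟨fun h => ?_, fun h => ?_⟩
    · by_contra hlt
      have hne' : w⁻¹ c ≠ w⁻¹ d := fun h => hcd.ne (w⁻¹.injective h)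
      have := simpleReflection_lt_simpleReflection i (lt_of_le_of_ne (not_lt.1 hlt) hne') hn1
      exact lt_asymm h this
    · exact simpleReflection_lt_simpleReflection i h hn2
  have hlt : ∀ (u : Equiv.Perm (Fin n)) (y), y ∈ inversions u → y.1 < y.2 := fun u y hy =>
    (Finset.mem_filter.1 hy).2.1
  refine ⟨(min a b, max a b), fun y hy => ?_, fun y hy => ?_⟩
  · by_cases hne : y = (min a b, max a b)
    · exact Finset.mem_insert.2 (Or.inl hne)
    · exact Finset.mem_insert_of_mem ((key y (hlt _ y hy) hne).1 hy)
  · by_cases hne : y = (min a b, max a b)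
    · exact Finset.mem_insert.2 (Or.inl hne)
    · exact Finset.mem_insert_of_mem ((key y (hlt _ y hy) hne).2 hy)

theorem card_inversions_mul_le (w : Equiv.Perm (Fin n)) (i : Fin (n - 1)) :
    (inversions (w * simpleReflection i)).card ≤ (inversions w).card + 1 := by
  obtain ⟨x, h, -⟩ := inversions_mul_simpleReflection w i
  exact (Finset.card_le_card h).trans (Finset.card_insert_le _ _)

/-- If a letter increases the number of inversions, then it only adds inversions. -/
theorem inversions_subset_of_card_lt (w : Equiv.Perm (Fin n)) (i : Fin (n - 1))
    (h : (inversions w).card < (inversions (w * simpleReflection i)).card) :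
    inversions w ⊆ inversions (w * simpleReflection i) := by
  obtain ⟨x, h1, h2⟩ := inversions_mul_simpleReflection w i
  have hx : x ∉ inversions w := fun hx => by
    rw [Finset.insert_eq_of_mem hx] at h1
    exact absurd (Finset.card_le_card h1) (not_le.2 h)
  intro y hy
  rcases Finset.mem_insert.1 (h2 hy) with rfl | hy'
  · exact absurd hy hx
  · exact hy'

theorem card_inversions_revPerm :
    (inversions (Fin.revPerm : Equiv.Perm (Fin n))).card = n * (n - 1) / 2 := by
  have h1 : inversions (Fin.revPerm : Equiv.Perm (Fin n)) =
      Finset.univ.filter fun x : Fin n × Fin n => x.1 < x.2 := by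
    ext x
    simp only [inversions, Finset.mem_filter, Finset.mem_univ, true_and, and_iff_left_iff_imp]
    intro h
    exact Fin.rev_lt_rev.2 h
  have h2 : (Finset.univ.filter fun x : Fin n × Fin n => x.1 < x.2).card =
      ∑ b : Fin n, (b : ℕ) := by
    rw [Finset.card_filter, Fintype.sum_prod_type_right]
    refine Finset.sum_congr rfl fun b _ => ?_
    rw [← Finset.card_filter]
    simp [Finset.filter_gt_eq_Iio]
  rw [h1, h2, Fin.sum_univ_eq_sum_range (fun i => i), Finset.sum_range_id]

theorem card_inversions_prefixProd_le {N : ℕ} (j : Fin N → Fin (n - 1)) {m m' : ℕ} (h : m ≤ m')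
    (hm : m' ≤ N) :
    (inversions (prefixProd j m')).card ≤ (inversions (prefixProd j m)).card + (m' - m) := by
  induction m', h using Nat.le_induction with
  | base => simp
  | succ k hk ih =>
    rw [prefixProd_succ j k hm]
    have := card_inversions_mul_le (prefixProd j k) (j ⟨k, hm⟩)
    have := ih (by omega)
    omega

/-- Along a reduced word of the longest element the sets of inversions increase: each of the
`n (n - 1) / 2` pairs has to be inverted, and every letter inverts at most one. -/
theorem inversions_prefixProd_subset {j : Fin (n * (n - 1) / 2) → Fin (n - 1)}
    (hj : IsReducedExpression j) {m m' : ℕ} (h : m ≤ m') (hm : m' ≤ n * (n - 1) / 2) :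
    inversions (prefixProd j m) ⊆ inversions (prefixProd j m') := by
  have hcard : ∀ m ≤ n * (n - 1) / 2, (inversions (prefixProd j m)).card = m := by
    intro m hm
    have h1 := card_inversions_prefixProd_le j hm le_rfl
    rw [show prefixProd j (n * (n - 1) / 2) = _ from hj, card_inversions_revPerm] at h1
    have h2 := card_inversions_prefixProd_le j (Nat.zero_le m) hm
    have h3 : (inversions (prefixProd j 0)).card = 0 := by
      rw [prefixProd_zero, Finset.card_eq_zero, inversions, Finset.filter_eq_empty_iff]
      rintro x - ⟨hx, hx'⟩
      exact lt_asymm hx hx'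
    omega
  induction m', h using Nat.le_induction with
  | base => exact subset_rfl
  | succ k hk ih =>
    refine (ih (by omega)).trans ?_
    have h1 := hcard k (by omega)
    have h2 := hcard (k + 1) hm
    rw [prefixProd_succ j k hm] at h2 ⊢
    exact inversions_subset_of_card_lt _ _ (by omega)

theorem mem_imageInitial {u : Equiv.Perm (Fin n)} {i : Fin (n - 1)} {a : Fin n} :
    a ∈ imageInitial u i ↔ ((u⁻¹ a : Fin n) : ℕ) ≤ i := by
  rw [imageInitial, Finset.mem_map_equiv]
  simp [Equiv.Perm.inv_def]

/-- The column sets of the Hamiltonians are separated: what leaves is smaller than what enters. -/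
theorem lt_of_mem_imageInitial {j : Fin (n * (n - 1) / 2) → Fin (n - 1)}
    (hj : IsReducedExpression j) {m m' : ℕ} (h : m ≤ m') (hm : m' ≤ n * (n - 1) / 2)
    {i i' : Fin (n - 1)} {a b : Fin n} (ha : a ∈ imageInitial (prefixProd j m) i)
    (ha' : a ∉ imageInitial (prefixProd j m') i') (hb : b ∈ imageInitial (prefixProd j m') i')
    (hb' : b ∉ imageInitial (prefixProd j m) i) : a < b := by
  rw [mem_imageInitial] at ha ha' hb hb'
  by_contra hab
  have hne : a ≠ b := by
    rintro rfl
    exact hb' ha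
  have hba : b < a := lt_of_le_of_ne (not_lt.1 hab) (Ne.symm hne)
  have h1 : (b, a) ∈ inversions (prefixProd j m) := by
    simp only [inversions, Finset.mem_filter, Finset.mem_univ, true_and, Fin.lt_def]
    exact ⟨hba, by omega⟩
  have h2 := inversions_prefixProd_subset hj h hm h1
  simp only [inversions, Finset.mem_filter, Finset.mem_univ, true_and, Fin.lt_def] at h2
  omega

theorem mem_imageInitial_revPerm {u : Equiv.Perm (Fin n)} {i : Fin (n - 1)} {a : Fin n} :
    a ∈ imageInitial (Fin.revPerm⁻¹ * u) i ↔ a.rev ∈ imageInitial u i := by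
  rw [mem_imageInitial, mem_imageInitial, _root_.mul_inv_rev, inv_inv, Equiv.Perm.mul_apply]
  rfl

theorem poissonBracket_hamiltonian_of_le {j : Fin (n * (n - 1) / 2) → Fin (n - 1)}
    (hj : IsReducedExpression j) {k l : Fin (n * (n - 1) / 2)} (hkl : k ≤ l)
    (X : Matrix (Fin n) (Fin n) ℂ) : poissonBracket (hamiltonian j l) (hamiltonian j k) X = 0 := by
  have hl : (l : ℕ) ≤ n * (n - 1) / 2 := l.2.le
  refine poissonBracket_minor_eq_zero _ _ ?_ ?_ ?_ X
  -- Reversal exchanges the row sets and the column sets, so the intersections have equal size.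
  · refine Finset.card_bij (fun a _ => a.rev) ?_ ?_ ?_
    · intro a ha
      simpa only [Finset.mem_inter, mem_imageInitial_revPerm] using ha
    · intro a _ b _ h
      exact Fin.rev_injective h
    · intro b hb
      refine ⟨b.rev, ?_, Fin.rev_rev b⟩
      simpa only [Finset.mem_inter, mem_imageInitial_revPerm, Fin.rev_rev] using hb
  · intro a ha ha' b hb hb'
    rw [mem_imageInitial_revPerm] at ha ha' hb hb'
    exact Fin.rev_lt_rev.1 (lt_of_mem_imageInitial hj hkl hl hb hb' ha ha')
  · intro a ha ha' b hb hb'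
    exact lt_of_mem_imageInitial hj hkl hl ha ha' hb hb'

theorem poissonBracket_hamiltonian {j : Fin (n * (n - 1) / 2) → Fin (n - 1)}
    (hj : IsReducedExpression j) (k l : Fin (n * (n - 1) / 2))
    (X : Matrix (Fin n) (Fin n) ℂ) : poissonBracket (hamiltonian j k) (hamiltonian j l) X = 0 := by
  rcases le_total l k with h | h
  · exact poissonBracket_hamiltonian_of_le hj h X
  · rw [poissonBracket_antisymm, poissonBracket_hamiltonian_of_le hj h, neg_zero]

/-! ### The action -/

/-- The Hamiltonian flow of the `k`-th Hamiltonian. -/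
noncomputable def hamiltonianFlow (j : Fin (n * (n - 1) / 2) → Fin (n - 1))
    (k : Fin (n * (n - 1) / 2)) : ℂ → Matrix (Fin n) (Fin n) ℂ → Matrix (Fin n) (Fin n) ℂ :=
  minorFlow
    ((imageInitial ((Fin.revPerm : Equiv.Perm (Fin n))⁻¹ * prefixProd j k) (j k)).orderEmbOfFin rfl)
    ((imageInitial (prefixProd j k) (j k)).orderEmbOfFin (by simp [imageInitial]))

theorem isAnalyticFlow_hamiltonianFlow (j : Fin (n * (n - 1) / 2) → Fin (n - 1))
    (k : Fin (n * (n - 1) / 2)) :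
    IsAnalyticFlow (hamiltonianFlow j k) (hamiltonianField (hamiltonian j k)) :=
  isAnalyticFlow_minorFlow (RelEmbedding.injective _) (RelEmbedding.injective _)

theorem contDiff_hamiltonian (j : Fin (n * (n - 1) / 2) → Fin (n - 1))
    (k : Fin (n * (n - 1) / 2)) : ContDiff ℂ ω (hamiltonian j k) := contDiff_minor _ _

end KZ

theorem corollary3p2 (n : ℕ) (j : Fin (n * (n - 1) / 2) → Fin (n - 1))
    (hj : KZ.IsReducedExpression j) :
    (∀ k, KZ.HasCompleteFlow (KZ.hamiltonian j k)) ∧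
      ∃ Φ : (Fin (n * (n - 1) / 2) → ℂ) → Matrix (Fin n) (Fin n) ℂ → Matrix (Fin n) (Fin n) ℂ,
        KZ.IsAnalyticHamiltonianAction Φ (KZ.hamiltonian j) := by
  have hflow := KZ.isAnalyticFlow_hamiltonianFlow j
  have hdiff : ∀ k, Differentiable ℂ (KZ.hamiltonian j k) := fun k =>
    (KZ.contDiff_hamiltonian j k).differentiable (by simp)
  have hcomm : ∀ k l s t X, KZ.hamiltonianFlow j k s (KZ.hamiltonianFlow j l t X) =
      KZ.hamiltonianFlow j l t (KZ.hamiltonianFlow j k s X) := fun k l s t X =>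
    (hflow k).commute (hflow l) (KZ.commute_hamiltonianField (KZ.contDiff_hamiltonian j k)
      (KZ.contDiff_hamiltonian j l) (KZ.poissonBracket_hamiltonian hj k l)) s t X
  refine ⟨fun k X₀ => ⟨fun t => KZ.hamiltonianFlow j k t X₀, (hflow k).zero_apply X₀,
    fun t => (hflow k).hasDerivAt t X₀⟩,
    KZ.composeFlows (KZ.hamiltonianFlow j) (List.finRange _), ?_⟩
  exact
    { zero_act := KZ.composeFlows_zero hflow _
      add_act := KZ.composeFlows_add hflow hcomm _
      analytic := contDiff_omega_iff_analyticOnNhd.1 (KZ.contDiff_composeFlows hflow _)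
      moment_analytic := fun k =>
        contDiff_omega_iff_analyticOnNhd.1 (KZ.contDiff_hamiltonian j k)
      generator := fun v X => by
        rw [KZ.hamiltonianField_sum _ _ _ hdiff, Fin.sum_univ_def]
        exact KZ.hasDerivAt_composeFlows hflow _ v X
      moment_hom := KZ.poissonBracket_hamiltonian hj
      moment_equivariant := fun v k X =>
        KZ.composeFlows_invariant (f := KZ.hamiltonian j k) (fun l t Y =>
          (hflow l).invariant (hdiff k) (fun Z =>
            (KZ.poissonBracket_eq_fderiv _ _ Z).symm.trans
              (KZ.poissonBracket_hamiltonian hj k l Z)) t Y) _ v X }
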